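/- Let $d\ge 0$, let $\mathbb J=\begin{bmatrix}0&I_d\\-I_d&0\end{bmatrix}$, and let $\mathsf{Sp}(\mathbb R^{2d})=\{S\in\mathsf M(2d,\mathbb R): S^T\mathbb JS=\mathbb J\}$ act on the Siegel upper half space $\mathbb H_d=\{\mathcal C=\mathcal A+\mathrm i\mathcal B:\ \mathcal A,\mathcal B\in\mathsf{sym}(d,\mathbb R),\ \mathcal B>0\}$ by $\Phi_S(\mathcal C)=(S_{21}+S_{22}\mathcal C)(S_{11}+S_{12}\mathcal C)^{-1}$, where $S_{ij}$ are the $d\times d$ blocks of $S$. Equip $\mathbb H_d$ with the symplectic form $\Omega_{\mathbb H_d}=\mathcal B^{-1}_{lj}\mathcal B^{-1}_{km}\,d\mathcal B_{lm}\wedge d\mathcal A_{jk}=-d\mathcal B^{-1}_{jk}\wedge d\mathcal A_{jk}$ (summation over repeated indices) and the Poisson bracket $$\{F,G\}_{\mathbb H_d}=-\Bigl(\frac{\partial F}{\partial\mathcal B^{-1}_{jk}}\frac{\partial G}{\partial\mathcal A_{jk}}-\frac{\partial G}{\partial\mathcal B^{-1}_{jk}}\frac{\partial F}{\partial\mathcal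 A_{jk}}\Bigr),$$ where $\partial F/\partial\mathcal A$ and $\partial F/\partial\mathcal B^{-1}$ are the symmetric matrices with $dF=\operatorname{tr}\bigl(\tfrac{\partial F}{\partial\mathcal A}d\mathcal A\bigr)+\operatorname{tr}\bigl(\tfrac{\partial F}{\partial\mathcal B^{-1}}d\mathcal B^{-1}\bigr)$. On $\mathsf{sym}(2d,\mathbb R)$ put $[\xi,\eta]=\xi\mathbb J^T\eta-\eta\mathbb J^T\xi$ and $\langle\xi,\eta\rangle=\operatorname{tr}(\xi\eta)$. Identify $\mathsf{sym}(2d,\mathbb R)$ with $\mathfrak{sp}(\mathbb R^{2d})$ by $\xi\mapsto\tilde\xi=\mathbb J^T\xi$, and with its own dual, hence with $\mathfrak{sp}(\mathbb R^{2d})^*$, by $\langle\cdot,\cdot\rangle$. Then the coadjoint action is $\mathrm{Ad}^*_{S^{-1}}\mu=S\mu S^T$, and $\mathrm{ad}^*_\xi\mu=\mathbb J\xi\mu-\mu\xi\mathbb J$. A momentum map of $\Phi$ is a map $\mathbf J:\mathbb H_d\to\mathsf{sym}(2d,\mathbb R)$, differentiable on $\mathbb H_d$, such that $\iota_{\xi_{\mathbb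 H_d}}\Omega_{\mathbb H_d}=d\langle\mathbf J(\cdot),\xi\rangle$ for all $\xi\in\mathsf{sym}(2d,\mathbb R)$, where $\xi_{\mathbb H_d}(\mathcal C)=\frac{d}{d\varepsilon}\big|_{\varepsilon=0}\Phi_{\exp(\varepsilon\tilde\xi)}(\mathcal C)$. Let $$\sigma(\mathcal C)=\begin{bmatrix}\mathcal B^{-1}&\mathcal B^{-1}\mathcal A\\ \mathcal A\mathcal B^{-1}&\mathcal A\mathcal B^{-1}\mathcal A+\mathcal B\end{bmatrix}.$$ (i) $\mathbf J=\sigma$ is a momentum map of $\Phi$, and every momentum map of $\Phi$ equals $\sigma$ up to an additive constant in $\mathsf{sym}(2d,\mathbb R)$. (ii) $\sigma$ is equivariant: $\sigma\circ\Phi_S=\mathrm{Ad}^*_{S^{-1}}\sigma=S\sigma S^T$ for all $S\in\mathsf{Sp}(\mathbb R^{2d})$; it is the only equivariant momentum map of $\Phi$. (iii) $\sigma$ is a Poisson map for $\{\cdot,\cdot\}_{\mathbb H_d}$ and the $(+)$-Lie–Poisson bracket $\{F,G\}^+(\mu)=\bigl\langle\mu,\bigl[\tfrac{\delta F}{\delta\mu},\tfrac{\delta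 G}{\delta\mu}\bigr]\bigr\rangle$ on $\mathsf{sym}(2d,\mathbb R)$, where $\delta F/\delta\mu$ is the gradient with respect to $\langle\cdot,\cdot\rangle$: for $\mathcal C\in\mathbb H_d$ and $F,G$ differentiable at $\sigma(\mathcal C)$ (in particular for smooth $F,G$), $\{F,G\}^+(\sigma(\mathcal C))=\{F\circ\sigma,G\circ\sigma\}_{\mathbb H_d}(\mathcal C)$. (iv) $\sigma$ is differentiable and maps $\mathbb H_d$ onto a single coadjoint orbit $\mathcal O$, and $\sigma^*\Omega^+_{\mathcal O}=\Omega_{\mathbb H_d}$, where $\Omega^+_{\mathcal O}(\mu)(\mathrm{ad}^*_\xi\mu,\mathrm{ad}^*_\eta\mu)=\langle\mu,[\xi,\eta]\rangle$ is the $(+)$-Kirillov–Kostant–Souriau form on $\mathcal O$. -/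

import Mathlib

open Matrix

noncomputable section

namespace Siegel

/-- The real vector space `sym(n, ℝ)` of symmetric real matrices. -/
def Sym (n : Type) : Submodule ℝ (Matrix n n ℝ) where
  carrier := {M | M.IsSymm}
  add_mem' ha hb := ha.add hb
  zero_mem' := Matrix.isSymm_zero
  smul_mem' c _ ha := ha.smul c

lemma Sym.transpose_coe {n : Type} (ξ : Sym n) : (ξ : Matrix n n ℝ)ᵀ = ξ := ξ.2

/-! ### The Siegel upper half space -/

/-- The real vector space of complex symmetric `d × d` matrices `𝒞 = 𝒜 + i ℬ`, in the real linear
coordinates `(𝒜, ℬ)`. -/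
abbrev CSym (d : ℕ) : Type := Sym (Fin d) × Sym (Fin d)

/-- The complex matrix `𝒜 + i ℬ`. -/
def toComplex {d : ℕ} (C : CSym d) : Matrix (Fin d) (Fin d) ℂ :=
  (C.1 : Matrix (Fin d) (Fin d) ℝ).map Complex.ofReal +
    Complex.I • (C.2 : Matrix (Fin d) (Fin d) ℝ).map Complex.ofReal

/-- The Siegel upper half space `ℍ_d`: all `𝒜 + i ℬ` with `𝒜`, `ℬ` real symmetric and `ℬ > 0`.
It is an open subset of the real vector space `CSym d`, which is thus its tangent space at each
point. -/
def UpperHalfSpace (d : ℕ) : Set (CSym d) :=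
  {C | (C.2 : Matrix (Fin d) (Fin d) ℝ).PosDef}

/-! ### The action of the symplectic group by linear fractional transformations -/

/-- The denominator `S₁₁ + S₁₂ 𝒞`. -/
def denom {d : ℕ} (S : Matrix (Fin d ⊕ Fin d) (Fin d ⊕ Fin d) ℝ) (C : CSym d) :
    Matrix (Fin d) (Fin d) ℂ :=
  S.toBlocks₁₁.map Complex.ofReal + S.toBlocks₁₂.map Complex.ofReal * toComplex C

/-- The numerator `S₂₁ + S₂₂ 𝒞`. -/
def numer {d : ℕ} (S : Matrix (Fin d ⊕ Fin d) (Fin d ⊕ Fin d) ℝ) (C : CSym d) :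
    Matrix (Fin d) (Fin d) ℂ :=
  S.toBlocks₂₁.map Complex.ofReal + S.toBlocks₂₂.map Complex.ofReal * toComplex C

/-- The generalized linear fractional transformation `(S₂₁ + S₂₂ 𝒞) (S₁₁ + S₁₂ 𝒞)⁻¹`. -/
def fracMatrix {d : ℕ} (S : Matrix (Fin d ⊕ Fin d) (Fin d ⊕ Fin d) ℝ) (C : CSym d) :
    Matrix (Fin d) (Fin d) ℂ :=
  numer S C * (denom S C)⁻¹

lemma toComplex_transpose {d : ℕ} (C : CSym d) : (toComplex C)ᵀ = toComplex C := by
  rw [toComplex, Matrix.transpose_add, Matrix.transpose_smul, ← Matrix.transpose_map,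
    ← Matrix.transpose_map, Sym.transpose_coe, Sym.transpose_coe]

lemma ofReal_conjTranspose {m n : Type} (A : Matrix m n ℝ) :
    (A.map Complex.ofReal)ᴴ = Aᵀ.map Complex.ofReal := by
  ext i j; simp [Matrix.conjTranspose_apply]

lemma toComplex_conjTranspose {d : ℕ} (C : CSym d) :
    (toComplex C)ᴴ = toComplex C -
      (2 * Complex.I) • (C.2 : Matrix (Fin d) (Fin d) ℝ).map Complex.ofReal := by
  rw [toComplex, Matrix.conjTranspose_add, Matrix.conjTranspose_smul, ofReal_conjTranspose,
    ofReal_conjTranspose, Sym.transpose_coe, Sym.transpose_coe, Complex.star_def, Complex.conj_I]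
  module

lemma block_relations {d : ℕ} (S : symplecticGroup (Fin d) ℝ) :
    let f : Matrix (Fin d) (Fin d) ℝ → Matrix (Fin d) (Fin d) ℂ := fun M => M.map Complex.ofReal
    let T : Matrix (Fin d ⊕ Fin d) (Fin d ⊕ Fin d) ℝ := S
    (f T.toBlocks₁₁)ᵀ * f T.toBlocks₂₁ = (f T.toBlocks₂₁)ᵀ * f T.toBlocks₁₁ ∧
    (f T.toBlocks₁₂)ᵀ * f T.toBlocks₂₂ = (f T.toBlocks₂₂)ᵀ * f T.toBlocks₁₂ ∧
    (f T.toBlocks₁₁)ᵀ * f T.toBlocks₂₂ - (f T.toBlocks₂₁)ᵀ * f T.toBlocks₁₂ = 1 ∧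
    (f T.toBlocks₂₂)ᵀ * f T.toBlocks₁₁ - (f T.toBlocks₁₂)ᵀ * f T.toBlocks₂₁ = 1 := by
  intro f T
  have h : fromBlocks T.toBlocks₁₁ T.toBlocks₁₂ T.toBlocks₂₁ T.toBlocks₂₂ ∈
      symplecticGroup (Fin d) ℝ := by
    rw [fromBlocks_toBlocks]; exact S.2
  obtain ⟨h1, h2, h3⟩ := SymplecticGroup.fromBlocks_mem_iff.1 h
  have key : ∀ X Y : Matrix (Fin d) (Fin d) ℝ, (f X)ᵀ * f Y = f (Xᵀ * Y) := fun X Y => by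
    change (X.map (Complex.ofRealHom))ᵀ * Y.map (Complex.ofRealHom) =
      (Xᵀ * Y).map Complex.ofRealHom
    rw [Matrix.map_mul, Matrix.transpose_map]
  have hsub : ∀ X Y : Matrix (Fin d) (Fin d) ℝ, f X - f Y = f (X - Y) := fun X Y => by
    ext i j; simp [f]
  have hone : f 1 = 1 := by
    ext i j; by_cases hij : i = j <;> simp [f, Matrix.one_apply, hij]
  refine ⟨by rw [key, key, h1], by rw [key, key, h2], by rw [key, key, hsub, h3, hone], ?_⟩
  rw [key, key, hsub, ← hone]
  congr 1
  have := congrArg Matrix.transpose h3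
  simpa [Matrix.transpose_sub, Matrix.transpose_mul] using this

lemma denom_transpose_mul_numer {d : ℕ} (S : symplecticGroup (Fin d) ℝ) (C : CSym d) :
    (denom S.1 C)ᵀ * numer S.1 C = (numer S.1 C)ᵀ * denom S.1 C := by
  obtain ⟨h1, h2, h3, h4⟩ := block_relations S
  have hC := toComplex_transpose C
  simp only [denom, numer, Matrix.transpose_add, Matrix.transpose_mul, hC]
  generalize toComplex C = Z at *
  linear_combination (norm := noncomm_ring) h1 + h3 * Z - Z * h4 + Z * h2 * Z

lemma denom_conjTranspose_mul_numer {d : ℕ} (S : symplecticGroup (Fin d) ℝ) (C : CSym d) :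
    (denom S.1 C)ᴴ * numer S.1 C - (numer S.1 C)ᴴ * denom S.1 C =
      (2 * Complex.I) • (C.2 : Matrix (Fin d) (Fin d) ℝ).map Complex.ofReal := by
  obtain ⟨h1, h2, h3, h4⟩ := block_relations S
  have hC := toComplex_conjTranspose C
  have hC' : (2 * Complex.I) • (C.2 : Matrix (Fin d) (Fin d) ℝ).map Complex.ofReal =
      toComplex C - (toComplex C)ᴴ := by rw [hC]; abel
  rw [hC']
  simp only [denom, numer, Matrix.conjTranspose_add, Matrix.conjTranspose_mul,
    ofReal_conjTranspose, Matrix.transpose_map] at *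
  generalize (toComplex C)ᴴ = W at *
  generalize toComplex C = Z at *
  linear_combination (norm := noncomm_ring) h1 + h3 * Z - W * h4 + W * h2 * Z

/-- The hermitian form of `ℬ > 0` is positive on nonzero complex vectors. -/
lemma posDef_complex {d : ℕ} {B : Matrix (Fin d) (Fin d) ℝ} (hB : B.PosDef) (w : Fin d → ℂ)
    (hw : w ≠ 0) : 0 < (star w ⬝ᵥ (B.map Complex.ofReal *ᵥ w)).re := by
  have h : (star w ⬝ᵥ (B.map Complex.ofReal *ᵥ w)).re =
      (fun i => (w i).re) ⬝ᵥ (B *ᵥ fun i => (w i).re) +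
        (fun i => (w i).im) ⬝ᵥ (B *ᵥ fun i => (w i).im) := by
    simp only [dotProduct, mulVec, Matrix.map_apply, Pi.star_apply, Complex.star_def,
      Complex.re_sum, Complex.mul_re, Complex.im_sum, Complex.mul_im, Complex.conj_re,
      Complex.conj_im, Complex.ofReal_re, Complex.ofReal_im]
    rw [← Finset.sum_add_distrib]
    refine Finset.sum_congr rfl fun i _ => ?_
    simp
  have hpos : ∀ x : Fin d → ℝ, 0 ≤ x ⬝ᵥ (B *ᵥ x) := fun x => by
    simpa using hB.posSemidef.dotProduct_mulVec_nonneg x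
  have hpos' : ∀ x : Fin d → ℝ, x ≠ 0 → 0 < x ⬝ᵥ (B *ᵥ x) := fun x hx => by
    simpa using hB.dotProduct_mulVec_pos hx
  rw [h]
  by_cases hr : (fun i => (w i).re) = 0
  · have hi : (fun i => (w i).im) ≠ 0 := fun hi => hw <| by
      ext i; exact Complex.ext (congrFun hr i) (congrFun hi i)
    exact add_pos_of_nonneg_of_pos (hpos _) (hpos' _ hi)
  · exact add_pos_of_pos_of_nonneg (hpos' _ hr) (hpos _)

lemma isUnit_det_denom {d : ℕ} (S : symplecticGroup (Fin d) ℝ) (C : UpperHalfSpace d) :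
    IsUnit (denom S.1 C.1).det := by
  rw [isUnit_iff_ne_zero]
  intro h0
  obtain ⟨v, hv, hPv⟩ := Matrix.exists_mulVec_eq_zero_iff.2 h0
  have h := denom_conjTranspose_mul_numer S C.1
  have h' := congrArg (fun M => star v ⬝ᵥ (M *ᵥ v)) h
  simp only [Matrix.sub_mulVec, ← Matrix.mulVec_mulVec, hPv, Matrix.mulVec_zero, sub_zero,
    Matrix.smul_mulVec, dotProduct_smul] at h'
  rw [Matrix.dotProduct_mulVec, ← Matrix.star_mulVec, hPv, star_zero, zero_dotProduct] at h'
  have hpos := posDef_complex C.2 v hv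
  rcases smul_eq_zero.1 h'.symm with h2 | h2
  · simp at h2
  · rw [h2] at hpos; simp at hpos

lemma fracMatrix_transpose {d : ℕ} (S : symplecticGroup (Fin d) ℝ) (C : UpperHalfSpace d) :
    (fracMatrix S.1 C.1)ᵀ = fracMatrix S.1 C.1 := by
  have hP := isUnit_det_denom S C
  have hPT : IsUnit ((denom S.1 C.1)ᵀ).det := by rwa [Matrix.det_transpose]
  have h := denom_transpose_mul_numer S C.1
  rw [fracMatrix, Matrix.transpose_mul, Matrix.transpose_nonsing_inv]
  calc ((denom S.1 C.1)ᵀ)⁻¹ * (numer S.1 C.1)ᵀ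
      = ((denom S.1 C.1)ᵀ)⁻¹ * ((numer S.1 C.1)ᵀ * denom S.1 C.1) * (denom S.1 C.1)⁻¹ := by
        rw [Matrix.mul_assoc, Matrix.mul_nonsing_inv_cancel_right _ _ hP]
    _ = _ := by
        rw [← h, Matrix.nonsing_inv_mul_cancel_left _ _ hPT]

lemma map_im_posDef {d : ℕ} (S : symplecticGroup (Fin d) ℝ) (C : UpperHalfSpace d) :
    ((fracMatrix S.1 C.1).map Complex.im).PosDef := by
  have hP := isUnit_det_denom S C
  have hsymm := fracMatrix_transpose S C
  refine Matrix.PosDef.of_dotProduct_mulVec_pos ?_ fun x hx => ?_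
  · ext i j
    simpa using congrArg Complex.im (congrFun (congrFun hsymm i) j)
  set M := fracMatrix S.1 C.1 with hM
  set P := denom S.1 C.1 with hPdef
  set Q := numer S.1 C.1 with hQdef
  let y : Fin d → ℂ := fun i => (x i : ℂ)
  let w : Fin d → ℂ := P⁻¹ *ᵥ y
  have hy : P *ᵥ w = y := by
    simp [w, Matrix.mulVec_mulVec, Matrix.mul_nonsing_inv _ hP]
  have hw : w ≠ 0 := fun h => hx <| by
    rw [h, Matrix.mulVec_zero] at hy
    ext i
    have := congrFun hy i
    simpa [y] using this.symm
  have hMy : M *ᵥ y = Q *ᵥ w := by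
    simp [hM, fracMatrix, w, Matrix.mulVec_mulVec, ← hPdef, ← hQdef]
  have h := congrArg (fun N => star w ⬝ᵥ (N *ᵥ w)) (denom_conjTranspose_mul_numer S C.1)
  simp only [Matrix.sub_mulVec, ← Matrix.mulVec_mulVec, Matrix.smul_mulVec, dotProduct_smul,
    dotProduct_sub] at h
  rw [← hPdef, ← hQdef, Matrix.dotProduct_mulVec, ← Matrix.star_mulVec, hy, ← hMy,
    Matrix.dotProduct_mulVec (star w), ← Matrix.star_mulVec, ← hMy] at h
  have hpos := posDef_complex C.2 w hw
  have e1 : star (M *ᵥ y) ⬝ᵥ y = star (star y ⬝ᵥ (M *ᵥ y)) := by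
    rw [Matrix.star_dotProduct]
  rw [e1] at h
  have him : (star y ⬝ᵥ (M *ᵥ y)).im = star x ⬝ᵥ (M.map Complex.im *ᵥ x) := by
    simp [dotProduct, mulVec, y]
  have h2 := congrArg Complex.im h
  simp only [smul_eq_mul, Complex.sub_im, Complex.star_def, Complex.conj_im, Complex.mul_im,
    Complex.mul_re, Complex.I_re, Complex.I_im] at h2
  norm_num at h2
  rw [← him]
  linarith

/-- The transformation `Φ_S : ℍ_d → ℍ_d`, `𝒞 ↦ (S₂₁ + S₂₂ 𝒞) (S₁₁ + S₁₂ 𝒞)⁻¹`, in the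
coordinates `(𝒜, ℬ)`, that is, (real part, imaginary part). -/
def Phi {d : ℕ} (S : symplecticGroup (Fin d) ℝ) (C : UpperHalfSpace d) : UpperHalfSpace d :=
  ⟨(⟨(fracMatrix S.1 C.1).map Complex.re, by
      ext i j
      simpa using congrArg Complex.re (congrFun (congrFun (fracMatrix_transpose S C) i) j)⟩,
    ⟨(fracMatrix S.1 C.1).map Complex.im, by
      ext i j
      simpa using congrArg Complex.im (congrFun (congrFun (fracMatrix_transpose S C) i) j)⟩),
    map_im_posDef S C⟩

lemma toComplex_Phi {d : ℕ} (S : symplecticGroup (Fin d) ℝ) (C : UpperHalfSpace d) :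
    toComplex (Phi S C : CSym d) = numer S.1 C.1 * (denom S.1 C.1)⁻¹ := by
  ext i j
  apply Complex.ext <;> simp [toComplex, Phi, fracMatrix]

lemma toComplex_injective {d : ℕ} : Function.Injective (toComplex (d := d)) := by
  intro C D h
  have h' : ∀ i j, toComplex C i j = toComplex D i j := fun i j => by rw [h]
  refine Prod.ext (Subtype.ext ?_) (Subtype.ext ?_) <;> ext i j
  · simpa [toComplex] using congrArg Complex.re (h' i j)
  · simpa [toComplex] using congrArg Complex.im (h' i j)

lemma blocks_mul {d : ℕ} (S T : Matrix (Fin d ⊕ Fin d) (Fin d ⊕ Fin d) ℝ) (C : CSym d) :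
    denom (S * T) C = S.toBlocks₁₁.map Complex.ofReal * denom T C +
        S.toBlocks₁₂.map Complex.ofReal * numer T C ∧
      numer (S * T) C = S.toBlocks₂₁.map Complex.ofReal * denom T C +
        S.toBlocks₂₂.map Complex.ofReal * numer T C := by
  have hST : S * T = fromBlocks
      (S.toBlocks₁₁ * T.toBlocks₁₁ + S.toBlocks₁₂ * T.toBlocks₂₁)
      (S.toBlocks₁₁ * T.toBlocks₁₂ + S.toBlocks₁₂ * T.toBlocks₂₂)
      (S.toBlocks₂₁ * T.toBlocks₁₁ + S.toBlocks₂₂ * T.toBlocks₂₁)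
      (S.toBlocks₂₁ * T.toBlocks₁₂ + S.toBlocks₂₂ * T.toBlocks₂₂) := by
    rw [← fromBlocks_multiply, fromBlocks_toBlocks, fromBlocks_toBlocks]
  have key : ∀ X Y Z W : Matrix (Fin d) (Fin d) ℝ, (X * Y + Z * W).map Complex.ofReal =
      X.map Complex.ofReal * Y.map Complex.ofReal +
        Z.map Complex.ofReal * W.map Complex.ofReal := fun X Y Z W => by
    ext i j
    simp [Matrix.mul_apply]
  simp only [denom, numer, hST, toBlocks_fromBlocks₁₁, toBlocks_fromBlocks₁₂,
    toBlocks_fromBlocks₂₁, toBlocks_fromBlocks₂₂, key]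
  constructor <;> noncomm_ring

/-- `Φ` is a left action of the symplectic group on the Siegel upper half space. -/
instance {d : ℕ} : MulAction (symplecticGroup (Fin d) ℝ) (UpperHalfSpace d) where
  smul := Phi
  one_smul C := by
    refine Subtype.ext (toComplex_injective ?_)
    change toComplex (Phi 1 C : CSym d) = _
    have h1 : (1 : Matrix (Fin d ⊕ Fin d) (Fin d ⊕ Fin d) ℝ) = fromBlocks 1 0 0 1 :=
      fromBlocks_one.symm
    have hd : denom (1 : symplecticGroup (Fin d) ℝ).1 C.1 = 1 := by
      rw [Submonoid.coe_one, h1, denom, toBlocks_fromBlocks₁₁, toBlocks_fromBlocks₁₂]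
      simp
    have hn : numer (1 : symplecticGroup (Fin d) ℝ).1 C.1 = toComplex C.1 := by
      rw [Submonoid.coe_one, h1, numer, toBlocks_fromBlocks₂₁, toBlocks_fromBlocks₂₂]
      simp
    rw [toComplex_Phi, hd, hn, inv_one, Matrix.mul_one]
  mul_smul S T C := by
    refine Subtype.ext (toComplex_injective ?_)
    change toComplex (Phi (S * T) C : CSym d) = toComplex (Phi S (Phi T C) : CSym d)
    have hT := isUnit_det_denom T C
    obtain ⟨hd, hn⟩ := blocks_mul S.1 T.1 C.1
    have e1 : denom (S * T).1 C.1 = denom S.1 (Phi T C).1 * denom T.1 C.1 := by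
      rw [Submonoid.coe_mul, hd, denom.eq_1 S.1, toComplex_Phi, add_mul, Matrix.mul_assoc, Matrix.mul_assoc,
        Matrix.nonsing_inv_mul _ hT, Matrix.mul_one]
    have e2 : numer (S * T).1 C.1 = numer S.1 (Phi T C).1 * denom T.1 C.1 := by
      rw [Submonoid.coe_mul, hn, numer.eq_1 S.1, toComplex_Phi, add_mul, Matrix.mul_assoc, Matrix.mul_assoc,
        Matrix.nonsing_inv_mul _ hT, Matrix.mul_one]
    rw [toComplex_Phi, toComplex_Phi, e1, e2, Matrix.mul_inv_rev, Matrix.mul_assoc,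
      Matrix.mul_nonsing_inv_cancel_left _ _ hT]

/-! ### The Lie algebra `sym(2d, ℝ)` and its identification with `sp(ℝ^{2d})` and its dual -/

/-- `sym(2d, ℝ)`, with matrices in `d × d` blocks. -/
abbrev Sym2 (d : ℕ) : Submodule ℝ (Matrix (Fin d ⊕ Fin d) (Fin d ⊕ Fin d) ℝ) :=
  Sym (Fin d ⊕ Fin d)

/-- The matrix `𝕁 = [[0, I], [-I, 0]]`. -/
def bbJ (d : ℕ) : Matrix (Fin d ⊕ Fin d) (Fin d ⊕ Fin d) ℝ := fromBlocks 0 1 (-1) 0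

lemma bbJ_transpose (d : ℕ) : (bbJ d)ᵀ = -bbJ d := by
  simp [bbJ, fromBlocks_transpose, fromBlocks_neg]

lemma bbJ_transpose_eq (d : ℕ) : (bbJ d)ᵀ = Matrix.J (Fin d) ℝ := by
  simp [bbJ, fromBlocks_transpose, Matrix.J]

/-- The inner product `⟨ξ, η⟩ = tr (ξ η)`, identifying `sym(n, ℝ)` with its dual. -/
def pairing {n : Type} [Fintype n] (ξ η : Sym n) : ℝ :=
  ((ξ : Matrix n n ℝ) * (η : Matrix n n ℝ)).trace

/-- The Lie bracket `[ξ, η] = ξ 𝕁ᵀ η - η 𝕁ᵀ ξ` on `sym(2d, ℝ)`. -/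
def symBracket {d : ℕ} (ξ η : Sym2 d) : Sym2 d :=
  ⟨ξ.1 * (bbJ d)ᵀ * η.1 - η.1 * (bbJ d)ᵀ * ξ.1, by
    change _ᵀ = _
    simp only [Matrix.transpose_sub, Matrix.transpose_mul, Matrix.transpose_neg,
      Sym.transpose_coe, bbJ_transpose]
    noncomm_ring⟩

/-- The element `ξ̃ = 𝕁ᵀ ξ` of `sp(ℝ^{2d})` that corresponds to `ξ ∈ sym(2d, ℝ)`. -/
def tilde {d : ℕ} (ξ : Sym2 d) : Matrix (Fin d ⊕ Fin d) (Fin d ⊕ Fin d) ℝ := (bbJ d)ᵀ * ξ.1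

lemma exp_tilde_mem {d : ℕ} (ξ : Sym2 d) (ε : ℝ) :
    NormedSpace.exp (ε • tilde ξ) ∈ symplecticGroup (Fin d) ℝ := by
  rw [SymplecticGroup.mem_iff, tilde, bbJ_transpose_eq]
  set J := Matrix.J (Fin d) ℝ
  set X := ε • (J * ξ.1) with hX
  have hJ : IsUnit J := (Matrix.isUnit_iff_isUnit_det _).2 (Matrix.isUnit_det_J (Fin d) ℝ)
  have hJ' := (Matrix.isUnit_iff_isUnit_det _).1 hJ
  have hconj : J⁻¹ * X * J = -Xᵀ := by
    rw [hX, Matrix.transpose_smul, Matrix.transpose_mul, Sym.transpose_coe, Matrix.J_transpose,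
      Matrix.mul_smul, Matrix.smul_mul, ← Matrix.mul_assoc, Matrix.nonsing_inv_mul _ hJ',
      Matrix.one_mul, Matrix.mul_neg, smul_neg, neg_neg]
  have h := Matrix.exp_conj' J X hJ
  rw [hconj, Matrix.exp_neg, Matrix.exp_transpose] at h
  have h2 : NormedSpace.exp X * J = J * ((NormedSpace.exp X)ᵀ)⁻¹ := by
    rw [h, ← Matrix.mul_assoc, ← Matrix.mul_assoc, Matrix.mul_nonsing_inv _ hJ', Matrix.one_mul]
  have hu : IsUnit ((NormedSpace.exp X)ᵀ).det := by
    rw [Matrix.det_transpose]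
    exact (Matrix.isUnit_iff_isUnit_det _).1 (Matrix.isUnit_exp X)
  rw [h2, Matrix.mul_assoc, Matrix.nonsing_inv_mul _ hu, Matrix.mul_one]

/-- The one-parameter subgroup `ε ↦ exp (ε ξ̃)` of the symplectic group. -/
def oneParam {d : ℕ} (ξ : Sym2 d) (ε : ℝ) : symplecticGroup (Fin d) ℝ :=
  ⟨NormedSpace.exp (ε • tilde ξ), exp_tilde_mem ξ ε⟩

/-- The adjoint action `Ad_S ξ = S⁻ᵀ ξ S⁻¹`, transported to `sym(2d, ℝ)`. -/
def Ad {d : ℕ} (S : symplecticGroup (Fin d) ℝ) (ξ : Sym2 d) : Sym2 d :=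
  ⟨(S⁻¹).1ᵀ * ξ.1 * (S⁻¹).1, by
    change _ᵀ = _
    simp only [Matrix.transpose_mul, Matrix.transpose_transpose, Sym.transpose_coe,
      Matrix.mul_assoc]⟩

lemma tilde_Ad {d : ℕ} (S : symplecticGroup (Fin d) ℝ) (ξ : Sym2 d) :
    tilde (Ad S ξ) = S.1 * tilde ξ * (S⁻¹).1 := by
  have h : S.1 * Matrix.J (Fin d) ℝ = Matrix.J (Fin d) ℝ * (S⁻¹).1ᵀ := by
    have h1 := SymplecticGroup.mem_iff.1 S.2
    have h2 : S.1ᵀ * (S⁻¹).1ᵀ = 1 := by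
      rw [← Matrix.transpose_mul, ← Submonoid.coe_mul, inv_mul_cancel, Submonoid.coe_one,
        Matrix.transpose_one]
    conv_rhs => rw [← h1, Matrix.mul_assoc (S.1 * _), h2, Matrix.mul_one]
  simp only [tilde, Ad, bbJ_transpose_eq, ← Matrix.mul_assoc, h]

/-- The dual map `Ad*_S μ = S⁻¹ μ S⁻ᵀ`; so the coadjoint action is `Ad*_{S⁻¹} μ = S μ Sᵀ`. -/
def coAd {d : ℕ} (S : symplecticGroup (Fin d) ℝ) (μ : Sym2 d) : Sym2 d :=
  ⟨(S⁻¹).1 * μ.1 * (S⁻¹).1ᵀ, by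
    change _ᵀ = _
    simp only [Matrix.transpose_mul, Matrix.transpose_transpose, Sym.transpose_coe,
      Matrix.mul_assoc]⟩

lemma pairing_coAd {d : ℕ} (S : symplecticGroup (Fin d) ℝ) (μ ξ : Sym2 d) :
    pairing (coAd S μ) ξ = pairing μ (Ad S ξ) := by
  simp only [pairing, coAd, Ad]
  rw [Matrix.mul_assoc, Matrix.mul_assoc, Matrix.trace_mul_comm]
  simp only [Matrix.mul_assoc]

/-- The dual `ad*_ξ μ = 𝕁 ξ μ - μ ξ 𝕁` of `ad_ξ = [ξ, ·]`. -/
def adStar {d : ℕ} (ξ μ : Sym2 d) : Sym2 d :=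
  ⟨bbJ d * ξ.1 * μ.1 - μ.1 * ξ.1 * bbJ d, by
    change _ᵀ = _
    simp only [Matrix.transpose_sub, Matrix.transpose_mul, Sym.transpose_coe, bbJ_transpose]
    noncomm_ring⟩

lemma pairing_adStar {d : ℕ} (ξ μ η : Sym2 d) :
    pairing (adStar ξ μ) η = pairing μ (symBracket ξ η) := by
  simp only [pairing, adStar, symBracket, bbJ_transpose]
  have h : (bbJ d * ξ.1 * μ.1 * η.1).trace = (μ.1 * (η.1 * bbJ d * ξ.1)).trace := by
    rw [Matrix.mul_assoc, Matrix.trace_mul_comm]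
    simp only [Matrix.mul_assoc]
  have e1 : (bbJ d * ξ.1 * μ.1 - μ.1 * ξ.1 * bbJ d) * η.1 =
    bbJ d * ξ.1 * μ.1 * η.1 - μ.1 * ξ.1 * bbJ d * η.1 := by noncomm_ring
  have e2 : μ.1 * (ξ.1 * -bbJ d * η.1 - η.1 * -bbJ d * ξ.1) =
    μ.1 * (η.1 * bbJ d * ξ.1) - μ.1 * ξ.1 * bbJ d * η.1 := by noncomm_ring
  rw [e1, e2, Matrix.trace_sub, Matrix.trace_sub, h]

/-! ### Coadjoint orbits and the `(+)`-KKS form -/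

/-- The coadjoint orbit through `μ`. -/
def coadjointOrbit {d : ℕ} (μ : Sym2 d) : Set (Sym2 d) :=
  {ν | ∃ S : symplecticGroup (Fin d) ℝ, ν = coAd S μ}

/-- The tangent space at `μ` of the coadjoint orbit through `μ`: the vectors `ad*_ξ μ`. -/
def orbitTangent {d : ℕ} (μ : Sym2 d) : Set (Sym2 d) :=
  {X | ∃ ξ : Sym2 d, X = adStar ξ μ}

/-- The `(+)`-Kirillov-Kostant-Souriau form at `μ`, which sends the tangent vectors `ad*_ξ μ` and
`ad*_η μ` to `⟨μ, [ξ, η]⟩`; by `kksForm_adStar` the choice of `ξ` and `η` does not matter. -/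
def kksForm {d : ℕ} (μ : Sym2 d) (X Y : orbitTangent μ) : ℝ :=
  pairing μ (symBracket X.2.choose Y.2.choose)

lemma symBracket_swap {d : ℕ} (μ ξ η : Sym2 d) :
    pairing μ (symBracket ξ η) = -pairing μ (symBracket η ξ) := by
  simp only [pairing, symBracket]
  rw [← Matrix.trace_neg]
  congr 1
  noncomm_ring

lemma kksForm_adStar {d : ℕ} (μ ξ η : Sym2 d) :
    kksForm μ ⟨adStar ξ μ, ξ, rfl⟩ ⟨adStar η μ, η, rfl⟩ = pairing μ (symBracket ξ η) := by
  have hX : ∃ ξ', adStar ξ μ = adStar ξ' μ := ⟨ξ, rfl⟩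
  have hY : ∃ η', adStar η μ = adStar η' μ := ⟨η, rfl⟩
  change pairing μ (symBracket hX.choose hY.choose) = _
  rw [← pairing_adStar, ← hX.choose_spec, pairing_adStar, symBracket_swap, ← pairing_adStar,
    ← hY.choose_spec, pairing_adStar, ← symBracket_swap]

/-! ### Gradients and the `(+)`-Lie-Poisson bracket -/

/-- The gradient of a linear functional on `sym(n, ℝ)`: the symmetric matrix that represents it
through the pairing `tr (ξ η)`, see `pairing_grad`. -/
def grad {n : Type} [DecidableEq n] (φ : Sym n →L[ℝ] ℝ) : Sym n :=
  ⟨Matrix.of fun j k => φ ⟨(1 / 2 : ℝ) • (Matrix.single j k 1 + Matrix.single k j 1), by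
      change _ᵀ = _
      simp [Matrix.transpose_add, add_comm]⟩, by
    ext j k
    simp only [Matrix.transpose_apply, Matrix.of_apply]
    congr 3
    exact add_comm _ _⟩

lemma pairing_grad {n : Type} [Fintype n] [DecidableEq n] (φ : Sym n →L[ℝ] ℝ) (η : Sym n) :
    pairing (grad φ) η = φ η := by
  have hη : η = ∑ j, ∑ k, (η.1 k j) •
      (⟨(1 / 2 : ℝ) • (Matrix.single j k 1 + Matrix.single k j 1), by
        change _ᵀ = _
        simp [Matrix.transpose_add, add_comm]⟩ : Sym n) := by
    ext a b
    have hs : η.1 b a = η.1 a b := congrFun (congrFun η.2 a) b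
    simp [Matrix.sum_apply, Matrix.single_apply, Finset.sum_add_distrib, ite_and, hs]
    ring
  conv_rhs => rw [hη]
  simp only [map_sum, map_smul, pairing, Matrix.trace, Matrix.diag, Matrix.mul_apply, grad,
    Matrix.of_apply, smul_eq_mul]
  exact Finset.sum_congr rfl fun j _ => Finset.sum_congr rfl fun k _ => mul_comm _ _

/-- The `(+)`-Lie-Poisson bracket `{F, G}(μ) = ⟨μ, [δF/δμ, δG/δμ]⟩` on `sym(2d, ℝ)`. -/
def liePoisson {d : ℕ} (F G : Sym2 d → ℝ) (μ : Sym2 d) : ℝ :=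
  pairing μ (symBracket (grad (fderiv ℝ F μ)) (grad (fderiv ℝ G μ)))

/-! ### Symplectic form and Poisson bracket on the Siegel upper half space -/

/-- The inverse of a symmetric matrix, as a symmetric matrix. -/
def symInv {n : Type} [Fintype n] [DecidableEq n] (P : Sym n) : Sym n :=
  ⟨(P.1)⁻¹, by
    change _ᵀ = _
    rw [Matrix.transpose_nonsing_inv, Sym.transpose_coe]⟩

/-- The symplectic form `Ω = ℬ⁻¹_{lj} ℬ⁻¹_{km} dℬ_{lm} ∧ d𝒜_{jk} = - dℬ⁻¹_{jk} ∧ d𝒜_{jk}` at `C`,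
on tangent vectors `U = (U_𝒜, U_ℬ)` and `V = (V_𝒜, V_ℬ)`. -/
def Omega {d : ℕ} (C U V : CSym d) : ℝ :=
  ∑ j, ∑ k, ∑ l, ∑ m, (symInv C.2).1 l j * (symInv C.2).1 k m *
    (U.2.1 l m * V.1.1 j k - V.2.1 l m * U.1.1 j k)

section OmegaEq

open scoped Matrix.Norms.Operator

lemma fderiv_inv_entry {d : ℕ} (C : UpperHalfSpace d) (j k : Fin d) (U : CSym d) :
    fderiv ℝ (fun D : CSym d => (symInv D.2).1 j k) C.1 U =
      -((C.1.2.1)⁻¹ * U.2.1 * (C.1.2.1)⁻¹) j k := by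
  obtain ⟨u, hu⟩ := Matrix.PosDef.isUnit C.2
  have h1 := hasFDerivAt_ringInverse (𝕜 := ℝ) u
  have h2 : (Ring.inverse : Matrix (Fin d) (Fin d) ℝ → Matrix (Fin d) (Fin d) ℝ) =
      fun M => M⁻¹ := by
    ext M; rw [Matrix.nonsing_inv_eq_ringInverse]
  rw [h2, hu] at h1
  let snd : CSym d →L[ℝ] Matrix (Fin d) (Fin d) ℝ :=
    (Sym (Fin d)).subtypeL.comp (ContinuousLinearMap.snd ℝ _ _)
  let entry : Matrix (Fin d) (Fin d) ℝ →L[ℝ] ℝ :=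
    (Matrix.entryLinearMap ℝ ℝ j k).toContinuousLinearMap
  have h4 := entry.hasFDerivAt.comp C.1 (HasFDerivAt.comp C.1 h1 snd.hasFDerivAt)
  have h5 : fderiv ℝ (fun D : CSym d => (symInv D.2).1 j k) C.1 = _ := h4.fderiv
  rw [h5, ← hu, ← Matrix.coe_units_inv]
  rfl

/-- The presentation `Ω = - dℬ⁻¹_{jk} ∧ d𝒜_{jk}`. -/
lemma Omega_eq {d : ℕ} (C : UpperHalfSpace d) (U V : CSym d) :
    Omega C.1 U V = -∑ j, ∑ k,
      (fderiv ℝ (fun D : CSym d => (symInv D.2).1 j k) C.1 U * V.1.1 j k -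
        fderiv ℝ (fun D : CSym d => (symInv D.2).1 j k) C.1 V * U.1.1 j k) := by
  simp only [fderiv_inv_entry]
  simp only [Omega, symInv]
  have hs : ∀ l j, (C.1.2.1)⁻¹ l j = (C.1.2.1)⁻¹ j l := fun l j =>
    congrFun (congrFun (symInv C.1.2).2 j) l
  rw [← Finset.sum_neg_distrib]
  refine Finset.sum_congr rfl fun j _ => ?_
  rw [← Finset.sum_neg_distrib]
  refine Finset.sum_congr rfl fun k _ => ?_
  have key : ∀ W : Matrix (Fin d) (Fin d) ℝ, ((C.1.2.1)⁻¹ * W * (C.1.2.1)⁻¹) j k =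
      ∑ l, ∑ m, (C.1.2.1)⁻¹ l j * (C.1.2.1)⁻¹ k m * W l m := fun W => by
    simp only [Matrix.mul_apply, Finset.sum_mul]
    rw [Finset.sum_comm]
    refine Finset.sum_congr rfl fun l _ => Finset.sum_congr rfl fun m _ => ?_
    rw [hs l j, hs k m]; ring
  rw [key, key]
  simp only [mul_sub, Finset.sum_sub_distrib, neg_mul, Finset.sum_mul, mul_assoc]
  ring

end OmegaEq

/-- The matrix `∂F/∂𝒜` of partial derivatives in the coordinates `(𝒜, ℬ⁻¹)`. -/
def gradA {d : ℕ} (F : CSym d → ℝ) (C : CSym d) : Sym (Fin d) :=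
  grad (fderiv ℝ (fun A => F (A, C.2)) C.1)

/-- The matrix `∂F/∂ℬ⁻¹` of partial derivatives in the coordinates `(𝒜, ℬ⁻¹)`. -/
def gradBinv {d : ℕ} (F : CSym d → ℝ) (C : CSym d) : Sym (Fin d) :=
  grad (fderiv ℝ (fun P => F (C.1, symInv P)) (symInv C.2))

/-- The Poisson bracket
`{F, G} = - (∂F/∂ℬ⁻¹_{jk} ∂G/∂𝒜_{jk} - ∂G/∂ℬ⁻¹_{jk} ∂F/∂𝒜_{jk})` on `ℍ_d`. -/
def poissonH {d : ℕ} (F G : CSym d → ℝ) (C : CSym d) : ℝ :=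
  -∑ j, ∑ k, ((gradBinv F C).1 j k * (gradA G C).1 j k -
    (gradBinv G C).1 j k * (gradA F C).1 j k)

/-! ### Momentum maps -/

/-- The infinitesimal generator `ξ_ℍ(C) = d/dε Φ_{exp (ε ξ̃)}(C)` at `ε = 0`. -/
def generator {d : ℕ} (ξ : Sym2 d) (C : UpperHalfSpace d) : CSym d :=
  deriv (fun ε : ℝ => (Phi (oneParam ξ ε) C : CSym d)) 0

/-- `J : ℍ_d → sym(2d, ℝ)` is a momentum map of the action `Φ`: for every `ξ`, the function
`⟨J(·), ξ⟩` is differentiable on `ℍ_d` and `i_{ξ_ℍ} Ω = d⟨J(·), ξ⟩`. Only the restriction of `J` to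
the open set `ℍ_d` matters. -/
def IsMomentumMap {d : ℕ} (J : CSym d → Sym2 d) : Prop :=
  ∀ (ξ : Sym2 d) (C : UpperHalfSpace d),
    DifferentiableAt ℝ (fun D => pairing (J D) ξ) (C : CSym d) ∧
    ∀ V : CSym d, fderiv ℝ (fun D => pairing (J D) ξ) (C : CSym d) V =
      Omega (C : CSym d) (generator ξ C) V

/-- Equivariance `J ∘ Φ_S = Ad*_{S⁻¹} J` on `ℍ_d`. -/
def IsEquivariant {d : ℕ} (J : CSym d → Sym2 d) : Prop :=
  ∀ (S : symplecticGroup (Fin d) ℝ) (C : UpperHalfSpace d),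
    J (Phi S C : CSym d) = coAd S⁻¹ (J (C : CSym d))

/-- The covariance matrix `σ(𝒞) = [[ℬ⁻¹, ℬ⁻¹ 𝒜], [𝒜 ℬ⁻¹, 𝒜 ℬ⁻¹ 𝒜 + ℬ]]`. -/
def sigma {d : ℕ} (C : CSym d) : Sym2 d :=
  ⟨fromBlocks (C.2.1)⁻¹ ((C.2.1)⁻¹ * C.1.1) (C.1.1 * (C.2.1)⁻¹)
      (C.1.1 * (C.2.1)⁻¹ * C.1.1 + C.2.1), by
    change _ᵀ = _
    simp only [fromBlocks_transpose, Matrix.transpose_add, Matrix.transpose_mul,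
      Matrix.transpose_nonsing_inv, Sym.transpose_coe, Matrix.mul_assoc]⟩

end Siegel

end

open Matrix

namespace Siegel

variable {d : ℕ}

/-! The differential statements rest on two block-matrix identities, in which `ξ_ℍ` is the vector
field generated by `ξ`: the momentum identity `Ω(ξ_ℍ, V) = ⟨dσ(V), ξ⟩` (`Omega_generator`) and the
infinitesimal equivariance `dσ(ξ_ℍ) = -ad*_ξ σ` (`fderiv_sigma_generator`). Substituting the second
into the first gives `Ω(ξ_ℍ, η_ℍ) = ⟨σ, [ξ, η]⟩` (`Omega_generator_generator`). Generators exhaust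
every tangent space (`exists_generator_eq`), so this formula already says that `σ` pulls the KKS
form back to `Ω`. It also gives the Poisson property: the generator of `δF/δμ` is the Hamiltonian
vector field of `F ∘ σ`, whence the bracket of `F ∘ σ` and `G ∘ σ` is `Ω` of two generators
(`poissonH_sigma`).

Equivariance under the whole group is proved without integrating the infinitesimal version. The
matrix `σ(𝒞) + i 𝕁ᵀ` equals `Z ℬ⁻¹ Zᴴ` with `Z = [1; 𝒞]`, and `S Z(𝒞) = Z(Φ_S 𝒞) D` with `D = S₁₁ +
S₁₂ 𝒞`. The factor `D` is absorbed because `D ℬ⁻¹ Dᴴ` is the inverse of the imaginary part of `Φ_S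
𝒞`; the real part of the resulting identity is `σ(Φ_S 𝒞) = S σ(𝒞) Sᵀ` (`sigma_Phi`). Shears and
block diagonal matrices join any two values of `σ`, so the image is one orbit (`sigma_image`).

Two momentum maps have the same differential, and `ℍ_d` is convex, so they differ by a constant. If
both are equivariant, the constant is fixed by the coadjoint action, hence zero
(`eq_zero_of_coAd_eq`). -/

lemma Omega_eq_trace (C U V : CSym d) :
    Omega C U V = (C.2.1⁻¹ * U.2.1 * C.2.1⁻¹ * V.1.1).trace -
      (C.2.1⁻¹ * V.2.1 * C.2.1⁻¹ * U.1.1).trace := by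
  have hP : ∀ i j, C.2.1⁻¹ i j = C.2.1⁻¹ j i := fun i j =>
    congrFun (congrFun (symInv C.2).2 j) i
  have key : ∀ X Y : Sym (Fin d), (C.2.1⁻¹ * X.1 * C.2.1⁻¹ * Y.1).trace =
      ∑ j, ∑ k, ∑ l, ∑ m, C.2.1⁻¹ l j * C.2.1⁻¹ k m * (X.1 l m * Y.1 j k) := fun X Y => by
    simp only [Matrix.trace, Matrix.diag, Matrix.mul_apply, Finset.sum_mul]
    refine Finset.sum_congr rfl fun j _ => Finset.sum_congr rfl fun k _ => ?_
    rw [Finset.sum_comm]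
    refine Finset.sum_congr rfl fun l _ => Finset.sum_congr rfl fun m _ => ?_
    have hY : Y.1 k j = Y.1 j k := congrFun (congrFun Y.2 j) k
    rw [hP l j, hP k m, hY]; ring
  rw [key, key]
  simp only [Omega, symInv, ← Finset.sum_sub_distrib, mul_sub]

/-! ### The trace pairing -/

lemma pairing_comm {n : Type} [Fintype n] (ξ η : Sym n) : pairing ξ η = pairing η ξ :=
  Matrix.trace_mul_comm _ _

lemma pairing_eq_sum {n : Type} [Fintype n] (ξ η : Sym n) :
    pairing ξ η = ∑ j, ∑ k, ξ.1 j k * η.1 j k := by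
  simp only [pairing, Matrix.trace, Matrix.diag, Matrix.mul_apply]
  refine Finset.sum_congr rfl fun j _ => Finset.sum_congr rfl fun k _ => ?_
  rw [show η.1 k j = η.1 j k from congrFun (congrFun η.2 j) k]

lemma eq_zero_of_pairing_self {n : Type} [Fintype n] (ξ : Sym n) (h : pairing ξ ξ = 0) :
    ξ = 0 := by
  rw [pairing_eq_sum] at h
  have h0 : ∀ j, 0 ≤ ∑ k, ξ.1 j k * ξ.1 j k := fun j =>
    Finset.sum_nonneg fun k _ => mul_self_nonneg _
  ext j k
  have h1 := (Finset.sum_eq_zero_iff_of_nonneg fun j _ => h0 j).1 h j (Finset.mem_univ j)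
  have h2 := (Finset.sum_eq_zero_iff_of_nonneg fun k _ => mul_self_nonneg _).1 h1 k
    (Finset.mem_univ k)
  simpa using h2

/-- On symmetric matrices `tr (ξ ξ)` is the sum of the squared entries, so the pairing is positive
definite and hence nondegenerate. -/
lemma pairing_left_ext {n : Type} [Fintype n] {ξ η : Sym n}
    (h : ∀ ζ, pairing ξ ζ = pairing η ζ) : ξ = η := by
  refine sub_eq_zero.1 (eq_zero_of_pairing_self _ ?_)
  have := h (ξ - η)
  simp only [pairing, AddSubgroupClass.coe_sub, Matrix.sub_mul, Matrix.trace_sub] at this ⊢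
  linarith

/-! ### Block algebra: the differential of `σ` against the generators -/

lemma exists_blocks (ξ : Sym2 d) : ∃ a b c : Matrix (Fin d) (Fin d) ℝ,
    aᵀ = a ∧ cᵀ = c ∧ ξ.1 = fromBlocks a b bᵀ c := by
  have h : ξ.1ᵀ = ξ.1 := ξ.2
  rw [← fromBlocks_toBlocks ξ.1, fromBlocks_transpose, fromBlocks_inj] at h
  refine ⟨ξ.1.toBlocks₁₁, ξ.1.toBlocks₁₂, ξ.1.toBlocks₂₂, h.1, h.2.2.2, ?_⟩
  rw [h.2.2.1, fromBlocks_toBlocks]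

lemma isUnit_det_im (C : UpperHalfSpace d) : IsUnit C.1.2.1.det :=
  (Matrix.isUnit_iff_isUnit_det _).1 (Matrix.PosDef.isUnit C.2)

/-- The differential of `σ` at `C`, see `fderiv_sigma`. -/
noncomputable def sigmaDeriv (C V : CSym d) : Matrix (Fin d ⊕ Fin d) (Fin d ⊕ Fin d) ℝ :=
  let A := C.1.1
  let P := C.2.1⁻¹
  let Q := -(P * V.2.1 * P)
  fromBlocks Q (Q * A + P * V.1.1) (V.1.1 * P + A * Q)
    (V.1.1 * P * A + A * Q * A + A * P * V.1.1 + V.2.1)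

lemma sigmaDeriv_transpose (C V : CSym d) : (sigmaDeriv C V)ᵀ = sigmaDeriv C V := by
  simp only [sigmaDeriv, fromBlocks_transpose, transpose_add, transpose_mul, transpose_neg,
    transpose_nonsing_inv, Sym.transpose_coe]
  congr 1 <;> noncomm_ring

/-- The vector field on `ℍ_d` induced by the element `[[a, b], [bᵀ, c]]` of `sym(2d, ℝ)`. -/
def generatorField (a b c : Matrix (Fin d) (Fin d) ℝ) (ha : aᵀ = a) (hc : cᵀ = c) (C : CSym d) :
    CSym d :=
  (⟨a + b * C.1.1 + C.1.1 * bᵀ + C.1.1 * c * C.1.1 - C.2.1 * c * C.2.1, by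
      change _ᵀ = _
      simp only [transpose_add, transpose_sub, transpose_mul, transpose_transpose,
        Sym.transpose_coe, ha, hc]
      noncomm_ring⟩,
    ⟨b * C.2.1 + C.2.1 * bᵀ + C.1.1 * c * C.2.1 + C.2.1 * c * C.1.1, by
      change _ᵀ = _
      simp only [transpose_add, transpose_mul, transpose_transpose, Sym.transpose_coe, hc]
      noncomm_ring⟩)

lemma trace_fromBlocks_mul (a b c e a' b' c' e' : Matrix (Fin d) (Fin d) ℝ) :
    (fromBlocks a b c e * fromBlocks a' b' c' e').trace =
      (a * a').trace + (b * c').trace + (c * b').trace + (e * e').trace := by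
  rw [fromBlocks_multiply]
  simp only [trace, diag, Fintype.sum_sum_type, fromBlocks_apply₁₁, fromBlocks_apply₂₂,
    Matrix.add_apply, Finset.sum_add_distrib]
  ring

/-- The momentum identity in explicit form. Once each inner factor `ℬ ℬ⁻¹` or `ℬ⁻¹ ℬ` is cancelled,
both sides are sums of traces of the same words up to cyclic permutation. -/
lemma Omega_generatorField (a b c : Matrix (Fin d) (Fin d) ℝ) (ha : aᵀ = a) (hc : cᵀ = c)
    (C : UpperHalfSpace d) (V : CSym d) :
    Omega C.1 (generatorField a b c ha hc C.1) V =
      (sigmaDeriv C.1 V * fromBlocks a b bᵀ c).trace := by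
  have hu := isUnit_det_im C
  rw [Omega_eq_trace, sigmaDeriv, trace_fromBlocks_mul]
  simp only [generatorField]
  have hA : C.1.1.1ᵀ = C.1.1.1 := Sym.transpose_coe _
  have hB : C.1.2.1ᵀ = C.1.2.1 := Sym.transpose_coe _
  have hX : V.1.1ᵀ = V.1.1 := Sym.transpose_coe _
  have hY : V.2.1ᵀ = V.2.1 := Sym.transpose_coe _
  have hP : (C.1.2.1⁻¹)ᵀ = C.1.2.1⁻¹ := by rw [transpose_nonsing_inv, hB]
  have h1 := Matrix.mul_nonsing_inv _ hu
  have h2 := Matrix.nonsing_inv_mul _ hu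
  -- The inverse is abstracted before `ℬ` itself, so that `P` and `B` become free noncommuting
  -- letters related by `h1` and `h2`.
  generalize C.1.1.1 = A at *
  generalize C.1.2.1⁻¹ = P at *
  generalize C.1.2.1 = B at *
  generalize V.1.1 = X at *
  generalize V.2.1 = Y at *
  have e1 : P * (b * B + B * bᵀ + A * c * B + B * c * A) * P * X =
      P * b * X + bᵀ * P * X + P * A * c * X + c * A * P * X := by
    linear_combination (norm := noncomm_ring) P * b * h1 * X + h2 * bᵀ * P * X +
      P * A * c * h1 * X + h2 * c * A * P * X
  have e2 : P * Y * P * (a + b * A + A * bᵀ + A * c * A - B * c * B) =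
      P * Y * P * a + P * Y * P * b * A + P * Y * P * A * bᵀ + P * Y * P * A * c * A -
        P * Y * c * B := by
    linear_combination (norm := noncomm_ring) -(P * Y * h2 * c * B)
  have e3 : (P * Y * c * B).trace = (Y * c).trace := by
    rw [trace_mul_comm]; simp only [← Matrix.mul_assoc, h1, Matrix.one_mul]
  have t1 : (P * b * X).trace = (X * P * b).trace := by
    rw [trace_mul_comm, ← Matrix.mul_assoc]
  have t2 : (bᵀ * P * X).trace = (P * X * bᵀ).trace := by
    rw [Matrix.mul_assoc, trace_mul_comm]
  have t3 : (P * A * c * X).trace = (X * P * A * c).trace := by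
    rw [trace_mul_comm]; simp only [Matrix.mul_assoc]
  have t4 : (c * A * P * X).trace = (A * P * X * c).trace := by
    simp only [Matrix.mul_assoc]; rw [trace_mul_comm]; simp only [Matrix.mul_assoc]
  have t5 : (P * Y * P * b * A).trace = (A * (P * Y * P) * b).trace := by
    rw [trace_mul_comm]; simp only [Matrix.mul_assoc]
  have t6 : (P * Y * P * A * c * A).trace = (A * (P * Y * P) * A * c).trace := by
    rw [trace_mul_comm]; simp only [Matrix.mul_assoc]
  rw [e1, e2]
  simp only [trace_add, trace_sub, Matrix.add_mul, Matrix.neg_mul, Matrix.mul_neg, trace_neg,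
    e3, t1, t2, t3, t4, t5, t6]
  ring

/-- This is the derivative at `ε = 0` of `S σ Sᵀ` with `S = exp (ε ξ̃)`, namely `ξ̃ σ + σ ξ̃ᵀ = 𝕁ᵀ ξ
σ + σ ξ 𝕁`; the minus sign comes from `𝕁ᵀ = -𝕁`. The proof compares blocks directly and does not use
equivariance. -/
lemma sigmaDeriv_generatorField (a b c : Matrix (Fin d) (Fin d) ℝ) (ha : aᵀ = a) (hc : cᵀ = c)
    (C : UpperHalfSpace d) (ξ : Sym2 d) (hξ : ξ.1 = fromBlocks a b bᵀ c) :
    sigmaDeriv C.1 (generatorField a b c ha hc C.1) = -(adStar ξ (sigma C.1)).1 := by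
  have hu := isUnit_det_im C
  simp only [sigmaDeriv, generatorField, adStar, hξ, sigma, bbJ, fromBlocks_multiply,
    sub_eq_add_neg, fromBlocks_neg, fromBlocks_add]
  have h1 := Matrix.mul_nonsing_inv _ hu
  have h2 := Matrix.nonsing_inv_mul _ hu
  generalize C.1.1.1 = A at *
  generalize C.1.2.1⁻¹ = P at *
  generalize C.1.2.1 = B at *
  have e1 : P * (b * B + B * bᵀ + A * c * B + B * c * A) * P =
      P * b + bᵀ * P + P * A * c + c * A * P := by
    linear_combination (norm := noncomm_ring) P * b * h1 + h2 * bᵀ * P +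
      P * A * c * h1 + h2 * c * A * P
  rw [e1]
  congr 1
  · noncomm_ring
  · linear_combination (norm := noncomm_ring) -(h2 * c * B)
  · linear_combination (norm := noncomm_ring) -(B * c * h1)
  · linear_combination (norm := noncomm_ring) -(B * c * h1 * A) - A * h2 * c * B

lemma exists_generatorField_eq (C : UpperHalfSpace d) (U : CSym d) :
    ∃ (a b c : Matrix (Fin d) (Fin d) ℝ) (ha : aᵀ = a) (hc : cᵀ = c),
      generatorField a b c ha hc C.1 = U := by
  have hu := isUnit_det_im C
  -- With `c = 0` the imaginary part of the field is `b ℬ + ℬ bᵀ`, and this `b` makes each summand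
  -- half of the target. The block `a` then corrects the real part.
  let b : Matrix (Fin d) (Fin d) ℝ := (1 / 2 : ℝ) • (U.2.1 * C.1.2.1⁻¹)
  refine ⟨U.1.1 - b * C.1.1.1 - C.1.1.1 * bᵀ, b, 0, ?_, transpose_zero, ?_⟩
  · simp only [transpose_sub, transpose_mul, transpose_transpose, Sym.transpose_coe]
    noncomm_ring
  · refine Prod.ext (Subtype.ext ?_) (Subtype.ext ?_)
    · simp only [generatorField, Matrix.mul_zero, Matrix.zero_mul]
      abel
    · simp only [generatorField, b, transpose_smul, transpose_mul, transpose_nonsing_inv,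
        Sym.transpose_coe, Matrix.mul_zero, Matrix.zero_mul, add_zero, Matrix.smul_mul,
        Matrix.mul_smul, ← Matrix.mul_assoc, Matrix.mul_nonsing_inv _ hu, Matrix.one_mul]
      rw [Matrix.mul_assoc, Matrix.nonsing_inv_mul _ hu, Matrix.mul_one, ← add_smul]
      norm_num

/-! ### Equivariance through a complex factorization -/

lemma ofReal_map_mul {m n p : Type} [Fintype n] (X : Matrix m n ℝ) (Y : Matrix n p ℝ) :
    (X * Y).map Complex.ofReal = X.map Complex.ofReal * Y.map Complex.ofReal := by
  ext i j; simp [Matrix.mul_apply]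

lemma ofReal_map_inv {n : Type} [Fintype n] [DecidableEq n] (X : Matrix n n ℝ)
    (h : IsUnit X.det) : (X⁻¹).map Complex.ofReal = (X.map Complex.ofReal)⁻¹ := by
  symm
  apply Matrix.inv_eq_left_inv
  rw [← ofReal_map_mul, Matrix.nonsing_inv_mul _ h]
  ext i j; by_cases hij : i = j <;> simp [Matrix.one_apply, hij]

/-- The matrix `[1; 𝒞]`, whose columns span a Lagrangian subspace. -/
def frame (C : CSym d) : Matrix (Fin d ⊕ Fin d) (Fin d) ℂ := fromRows 1 (toComplex C)

/-- The rank `d` factorization of `σ(𝒞) + i 𝕁ᵀ`. -/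
lemma sigma_factorization (C : UpperHalfSpace d) :
    frame C.1 * (C.1.2.1.map Complex.ofReal)⁻¹ *
        (frame C.1)ᴴ =
      (sigma C.1).1.map Complex.ofReal + Complex.I • ((bbJ d)ᵀ).map Complex.ofReal := by
  have hu := isUnit_det_im C
  have h1 : C.1.2.1.map Complex.ofReal * (C.1.2.1⁻¹).map Complex.ofReal = 1 := by
    rw [← ofReal_map_mul, Matrix.mul_nonsing_inv _ hu]
    ext i j; by_cases hij : i = j <;> simp [Matrix.one_apply, hij]
  have h2 : (C.1.2.1⁻¹).map Complex.ofReal * C.1.2.1.map Complex.ofReal = 1 :=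
    _root_.mul_eq_one_comm.1 h1
  have hJ : ((bbJ d)ᵀ).map Complex.ofReal = fromBlocks 0 (-1) 1 0 := by
    rw [bbJ, fromBlocks_transpose, fromBlocks_map]
    congr 1 <;> ext i j <;> by_cases hij : j = i <;>
      simp [Matrix.one_apply, hij, eq_comm (a := i)]
  have hadd : ∀ X Y : Matrix (Fin d) (Fin d) ℝ, (X + Y).map Complex.ofReal =
      X.map Complex.ofReal + Y.map Complex.ofReal := fun X Y => by ext; simp
  rw [← ofReal_map_inv _ hu, hJ, frame, fromRows_mul, conjTranspose_fromRows_eq_fromCols_conjTranspose,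
    fromRows_mul_fromCols, toComplex_conjTranspose]
  simp only [sigma, fromBlocks_map, ofReal_map_mul, hadd, fromBlocks_smul, fromBlocks_add]
  simp only [toComplex, conjTranspose_one]
  generalize C.1.1.1.map Complex.ofReal = A at *
  generalize (C.1.2.1⁻¹).map Complex.ofReal = P at *
  generalize C.1.2.1.map Complex.ofReal = B at *
  have hsub : A + Complex.I • B - (2 * Complex.I) • B = A - Complex.I • B := by module
  rw [hsub]
  congr 1
  · simp
  · simp only [Matrix.one_mul, Matrix.mul_sub, Matrix.mul_smul, h2]; simp [sub_eq_add_neg]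
  · simp only [Matrix.mul_one, Matrix.add_mul, Matrix.smul_mul, h1]
  · simp only [Matrix.add_mul, Matrix.mul_sub, Matrix.smul_mul, Matrix.mul_smul, Matrix.mul_assoc,
      h1, h2, Matrix.mul_one]
    have hI : Complex.I • Complex.I • B = -B := by
      rw [smul_smul, Complex.I_mul_I, neg_one_smul]
    simp only [← Matrix.mul_assoc, Matrix.one_mul]
    linear_combination (norm := module) (-1 : ℂ) • hI

/-- Write `D`, `N` for denominator and numerator and `ℬ'` for the new imaginary part. Putting `N =
Φ_S(𝒞) D` into `Dᴴ N - Nᴴ D = 2i ℬ` yields `Dᴴ ℬ' D = ℬ`, which is then inverted. -/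
lemma denom_mul_inv_mul_conjTranspose (S : symplecticGroup (Fin d) ℝ) (C : UpperHalfSpace d) :
    denom S.1 C.1 * (C.1.2.1.map Complex.ofReal)⁻¹ * (denom S.1 C.1)ᴴ =
      ((Phi S C).1.2.1.map Complex.ofReal)⁻¹ := by
  have hD := isUnit_det_denom S C
  have h := denom_conjTranspose_mul_numer S C.1
  have hN : numer S.1 C.1 = toComplex (Phi S C).1 * denom S.1 C.1 := by
    rw [toComplex_Phi, Matrix.mul_assoc, Matrix.nonsing_inv_mul _ hD, Matrix.mul_one]
  rw [hN, conjTranspose_mul, toComplex_conjTranspose] at h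
  have h' : (denom S.1 C.1)ᴴ * (Phi S C).1.2.1.map Complex.ofReal * denom S.1 C.1 =
      C.1.2.1.map Complex.ofReal := by
    have h2 : (2 * Complex.I) • ((denom S.1 C.1)ᴴ * (Phi S C).1.2.1.map Complex.ofReal *
        denom S.1 C.1) = (2 * Complex.I) • C.1.2.1.map Complex.ofReal := by
      rw [← h]
      simp only [Matrix.mul_sub, Matrix.sub_mul, Matrix.mul_smul, Matrix.smul_mul,
        Matrix.mul_assoc]
      abel
    exact smul_right_injective _ (by simp) h2
  have hDH : IsUnit ((denom S.1 C.1)ᴴ).det := by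
    rw [det_conjTranspose]; exact hD.star
  rw [← h', Matrix.mul_inv_rev, Matrix.mul_inv_rev, Matrix.mul_nonsing_inv_cancel_left _ _ hD,
    Matrix.mul_assoc, Matrix.nonsing_inv_mul _ hDH, Matrix.mul_one]

/-- The fractional linear action is the linear action of `S` on the column span of `[1; 𝒞]`, with
the basis renormalized by the denominator. -/
lemma map_mul_fromRows (S : symplecticGroup (Fin d) ℝ) (C : UpperHalfSpace d) :
    S.1.map Complex.ofReal * frame C.1 =
      frame (Phi S C).1 * denom S.1 C.1 := by
  have hD := isUnit_det_denom S C
  conv_lhs => rw [← fromBlocks_toBlocks S.1]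
  rw [frame, frame, fromBlocks_map, ← fromRows_fromCols_eq_fromBlocks, fromRows_mul, fromCols_mul_fromRows, fromCols_mul_fromRows,
    fromRows_mul, toComplex_Phi, Matrix.mul_assoc, Matrix.nonsing_inv_mul _ hD]
  simp [denom, numer]

lemma sigma_Phi (S : symplecticGroup (Fin d) ℝ) (C : UpperHalfSpace d) :
    (sigma (Phi S C).1).1 = S.1 * (sigma C.1).1 * S.1ᵀ := by
  have h := sigma_factorization (Phi S C)
  rw [← denom_mul_inv_mul_conjTranspose] at h
  have e : frame (Phi S C).1 *
      (denom S.1 C.1 * (C.1.2.1.map Complex.ofReal)⁻¹ * (denom S.1 C.1)ᴴ) *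
        (frame (Phi S C).1)ᴴ =
      (frame (Phi S C).1 * denom S.1 C.1) * (C.1.2.1.map Complex.ofReal)⁻¹ *
        (frame (Phi S C).1 * denom S.1 C.1)ᴴ := by
    rw [conjTranspose_mul]; simp only [Matrix.mul_assoc]
  have e2 : S.1.map Complex.ofReal * frame C.1 *
      (C.1.2.1.map Complex.ofReal)⁻¹ *
        (S.1.map Complex.ofReal * frame C.1)ᴴ =
      S.1.map Complex.ofReal * (frame C.1 *
      (C.1.2.1.map Complex.ofReal)⁻¹ * (frame C.1)ᴴ) *
        (S.1.map Complex.ofReal)ᴴ := by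
    rw [conjTranspose_mul]; simp only [Matrix.mul_assoc]
  rw [e, ← map_mul_fromRows, e2, sigma_factorization, Matrix.mul_add, Matrix.add_mul,
    Matrix.mul_smul, Matrix.smul_mul, ofReal_conjTranspose] at h
  simp only [← ofReal_map_mul] at h
  ext i j
  -- The real part isolates `σ` and `S σ Sᵀ`; the multiples of `i` are real matrices times `i` and
  -- drop out.
  have h' := congrArg Complex.re (congrFun (congrFun h i) j)
  simpa using h'.symm

lemma isEquivariant_sigma : IsEquivariant (sigma (d := d)) := fun S C =>
  Subtype.ext <| by rw [sigma_Phi]; simp only [coAd, inv_inv]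

/-! ### Coadjoint fixed points and the orbit of `σ` -/

/-- The symplectic matrix `[[1, 0], [X, 1]]`. -/
def shear (X : Sym (Fin d)) : symplecticGroup (Fin d) ℝ :=
  ⟨fromBlocks 1 0 X.1 1, SymplecticGroup.fromBlocks_mem_iff.2
    ⟨by simp [Sym.transpose_coe], by simp, by simp⟩⟩

/-- The symplectic matrix `[[L⁻ᵀ, 0], [0, L]]`. -/
noncomputable def blockDiag (L : Matrix (Fin d) (Fin d) ℝ) (hL : IsUnit L.det) : symplecticGroup (Fin d) ℝ :=
  ⟨fromBlocks (L⁻¹)ᵀ 0 0 L, SymplecticGroup.fromBlocks_mem_iff.2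
    ⟨by simp, by simp, by simp [Matrix.nonsing_inv_mul _ hL]⟩⟩

lemma coAd_inv_coe (S : symplecticGroup (Fin d) ℝ) (μ : Sym2 d) :
    (coAd S⁻¹ μ).1 = S.1 * μ.1 * S.1ᵀ := by
  simp only [coAd, inv_inv]

lemma coAd_mul (S T : symplecticGroup (Fin d) ℝ) (μ : Sym2 d) :
    coAd (S * T) μ = coAd T (coAd S μ) := by
  refine Subtype.ext ?_
  simp only [coAd, _root_.mul_inv_rev, Submonoid.coe_mul, transpose_mul, Matrix.mul_assoc]

/-- The zero matrix is the only fixed point of the coadjoint action. -/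
lemma eq_zero_of_coAd_eq (μ : Sym2 d) (h : ∀ S : symplecticGroup (Fin d) ℝ, coAd S⁻¹ μ = μ) :
    μ = 0 := by
  obtain ⟨a, b, c, ha, hc, hμ⟩ := exists_blocks μ
  -- The element `diag(1/2, 2)` multiplies the diagonal blocks `a` and `c` by `1/4` and `4`, so both
  -- vanish.
  have h2 : IsUnit ((2 : ℝ) • (1 : Matrix (Fin d) (Fin d) ℝ)).det := by simp
  have hinv : ((2 : ℝ) • (1 : Matrix (Fin d) (Fin d) ℝ))⁻¹ = (1 / 2 : ℝ) • 1 := by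
    apply Matrix.inv_eq_left_inv; simp
  have hd := congrArg Subtype.val (h (blockDiag _ h2))
  rw [coAd_inv_coe, hμ] at hd
  simp only [blockDiag, hinv, fromBlocks_transpose, fromBlocks_multiply, fromBlocks_inj] at hd
  obtain ⟨ha0, -, -, hc0⟩ := hd
  have ha' : a = 0 := by
    ext i j
    have := congrFun (congrFun ha0 i) j
    simp at this ⊢
    linarith
  have hc' : c = 0 := by
    ext i j
    have := congrFun (congrFun hc0 i) j
    simp at this ⊢
    linarith
  -- This is the lower right block of the invariance under a shear. Taking `X = 1` makes `b`
  -- antisymmetric, and `X` the `i`-th diagonal matrix unit kills the off-diagonal entries of row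
  -- `i`.
  have hX : ∀ X : Sym (Fin d), X.1 * b + bᵀ * X.1 = 0 := fun X => by
    have hs := congrArg Subtype.val (h (shear X))
    rw [coAd_inv_coe, hμ, ha', hc'] at hs
    simp only [shear, fromBlocks_transpose, fromBlocks_multiply, fromBlocks_inj] at hs
    simpa [Sym.transpose_coe, add_comm] using hs.2.2.2
  have hanti : bᵀ = -b := by
    have := hX ⟨1, Matrix.isSymm_one⟩
    simp only [Matrix.one_mul, Matrix.mul_one] at this
    exact eq_neg_of_add_eq_zero_right this
  have hb : b = 0 := by
    ext i j
    by_cases hij : i = j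
    · have := congrFun (congrFun hanti i) j
      subst hij
      simp at this ⊢
      linarith
    · have := congrFun (congrFun (hX ⟨Matrix.single i i 1, by
        change _ᵀ = _; simp⟩) i) j
      simpa [hanti, hij, Matrix.mul_apply, Matrix.single_apply] using this
  refine Subtype.ext ?_
  rw [hμ, ha', hb, hc']
  simp

lemma coAd_shear_sigma (A X B : Sym (Fin d)) :
    coAd (shear X)⁻¹ (sigma (A, B)) = sigma (A + X, B) := by
  refine Subtype.ext ?_
  rw [coAd_inv_coe]
  simp only [shear, sigma, fromBlocks_transpose, fromBlocks_multiply, Submodule.coe_add,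
    Sym.transpose_coe, transpose_one, transpose_zero]
  congr 1 <;> noncomm_ring

lemma coAd_blockDiag_sigma (L : Matrix (Fin d) (Fin d) ℝ) (hL : IsUnit L.det)
    (B B' : Sym (Fin d)) (h : B'.1 = L * B.1 * Lᵀ) :
    coAd (blockDiag L hL)⁻¹ (sigma (0, B)) = sigma (0, B') := by
  refine Subtype.ext ?_
  rw [coAd_inv_coe]
  simp only [blockDiag, sigma, fromBlocks_transpose, fromBlocks_multiply, h,
    Matrix.mul_inv_rev, transpose_nonsing_inv, transpose_transpose]
  simp [Matrix.mul_assoc]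

open scoped MatrixOrder Matrix.Norms.L2Operator in
-- Factor `B = N Nᵀ` and `B' = N' N'ᵀ` with invertible factors; then `L = N' N⁻¹`.
lemma exists_congruence {B B' : Matrix (Fin d) (Fin d) ℝ} (hB : B.PosDef) (hB' : B'.PosDef) :
    ∃ L : Matrix (Fin d) (Fin d) ℝ, IsUnit L.det ∧ B' = L * B * Lᵀ := by
  have key : ∀ {M : Matrix (Fin d) (Fin d) ℝ}, M.PosDef →
      ∃ N : Matrix (Fin d) (Fin d) ℝ, IsUnit N.det ∧ M = N * Nᵀ := fun {M} hM => by
    obtain ⟨N, hN⟩ := CStarAlgebra.nonneg_iff_eq_star_mul_self.1 hM.posSemidef.nonneg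
    rw [star_eq_conjTranspose, conjTranspose_eq_transpose_of_trivial] at hN
    refine ⟨Nᵀ, ?_, by rw [transpose_transpose, hN]⟩
    have := (Matrix.isUnit_iff_isUnit_det _).1 hM.isUnit
    rw [hN, det_mul] at this
    exact isUnit_of_mul_isUnit_left this
  obtain ⟨N, hN, rfl⟩ := key hB
  obtain ⟨N', hN', rfl⟩ := key hB'
  refine ⟨N' * N⁻¹, ?_, ?_⟩
  · rw [det_mul]; exact hN'.mul ((Matrix.isUnit_nonsing_inv_det_iff).2 hN)
  · have hNT : IsUnit Nᵀ.det := by rwa [det_transpose]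
    rw [transpose_mul, transpose_nonsing_inv, Matrix.mul_assoc N', ← Matrix.mul_assoc N⁻¹ N,
      Matrix.nonsing_inv_mul _ hN, Matrix.one_mul, Matrix.mul_assoc N',
      ← Matrix.mul_assoc Nᵀ, Matrix.mul_nonsing_inv _ hNT, Matrix.one_mul]

/-- The symplectic group acts transitively on the image of `σ`. -/
lemma exists_coAd_sigma_eq (C D : UpperHalfSpace d) :
    ∃ S : symplecticGroup (Fin d) ℝ, sigma D.1 = coAd S (sigma C.1) := by
  obtain ⟨L, hL, h⟩ := exists_congruence C.2 D.2
  have h1 := coAd_shear_sigma C.1.1 (-C.1.1) C.1.2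
  rw [add_neg_cancel] at h1
  have h2 := coAd_blockDiag_sigma L hL C.1.2 D.1.2 h
  have h3 := coAd_shear_sigma 0 D.1.1 D.1.2
  rw [zero_add] at h3
  -- Remove the real part of `C`, carry its imaginary part to that of `D`, then add the real part of
  -- `D`. The order is left to right because `coAd` is a right action.
  exact ⟨(shear (-C.1.1))⁻¹ * (blockDiag L hL)⁻¹ * (shear D.1.1)⁻¹, by
    rw [coAd_mul, coAd_mul, h1, h2, h3]⟩

lemma sigma_image (C : UpperHalfSpace d) :
    sigma '' UpperHalfSpace d = coadjointOrbit (sigma C.1) := by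
  ext μ
  constructor
  · rintro ⟨D, hD, rfl⟩
    exact exists_coAd_sigma_eq C ⟨D, hD⟩
  · rintro ⟨S, rfl⟩
    exact ⟨(Phi S⁻¹ C).1, (Phi S⁻¹ C).2, by rw [isEquivariant_sigma, inv_inv]⟩

/-! ### Derivatives of `σ`, of the inverse and of the group action -/

/-- The symmetric part of a square matrix. -/
noncomputable def symPart (n : Type) : Matrix n n ℝ →ₗ[ℝ] Sym n where
  toFun M := ⟨(1 / 2 : ℝ) • (M + Mᵀ), by
    change _ᵀ = _
    rw [transpose_smul, transpose_add, transpose_transpose, add_comm]⟩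
  map_add' M N := Subtype.ext <| by
    simp only [transpose_add, Submodule.coe_add]; module
  map_smul' r M := Subtype.ext <| by
    simp only [transpose_smul, RingHom.id_apply, Submodule.coe_smul]; module

lemma symPart_eq {n : Type} (M : Matrix n n ℝ) (h : Mᵀ = M) : symPart n M = ⟨M, h⟩ := by
  refine Subtype.ext ?_
  change (1 / 2 : ℝ) • (M + Mᵀ) = M
  rw [h]; module

/-- `fromBlocks` as a linear map. -/
def fromBlocksLinear (d : ℕ) : (Matrix (Fin d) (Fin d) ℝ × Matrix (Fin d) (Fin d) ℝ) ×
    (Matrix (Fin d) (Fin d) ℝ × Matrix (Fin d) (Fin d) ℝ) →ₗ[ℝ]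
      Matrix (Fin d ⊕ Fin d) (Fin d ⊕ Fin d) ℝ where
  toFun x := fromBlocks x.1.1 x.1.2 x.2.1 x.2.2
  map_add' x y := by simp [fromBlocks_add]
  map_smul' r x := by simp [fromBlocks_smul]

section Norms

open scoped Matrix.Norms.Operator

lemma hasFDerivAt_matrix_inv {n : Type} [Fintype n] [DecidableEq n] {𝕜 : Type} [RCLike 𝕜]
    (M : Matrix n n 𝕜) (h : IsUnit M.det) :
    HasFDerivAt (𝕜 := ℝ) (fun N : Matrix n n 𝕜 => N⁻¹)
      (-ContinuousLinearMap.mulLeftRight ℝ (Matrix n n 𝕜) M⁻¹ M⁻¹) M := by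
  obtain ⟨u, rfl⟩ := (Matrix.isUnit_iff_isUnit_det _).2 h
  have h1 := hasFDerivAt_ringInverse (𝕜 := ℝ) u
  have h2 : (Ring.inverse : Matrix n n 𝕜 → Matrix n n 𝕜) = fun M => M⁻¹ := by
    ext M; rw [Matrix.nonsing_inv_eq_ringInverse]
  rwa [h2, Matrix.coe_units_inv] at h1

lemma differentiableAt_and_fderiv_sigma (C : UpperHalfSpace d) :
    DifferentiableAt ℝ (sigma (d := d)) C.1 ∧ ∀ V : CSym d,
      fderiv ℝ sigma C.1 V = ⟨sigmaDeriv C.1 V, sigmaDeriv_transpose C.1 V⟩ := by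
  let im : CSym d →L[ℝ] Matrix (Fin d) (Fin d) ℝ :=
    (Sym (Fin d)).subtypeL.comp (ContinuousLinearMap.snd ℝ _ _)
  let re : CSym d →L[ℝ] Matrix (Fin d) (Fin d) ℝ :=
    (Sym (Fin d)).subtypeL.comp (ContinuousLinearMap.fst ℝ _ _)
  have hB : HasFDerivAt (fun D : CSym d => D.2.1) im C.1 := im.hasFDerivAt
  have hA : HasFDerivAt (fun D : CSym d => D.1.1) re C.1 := re.hasFDerivAt
  have hP := HasFDerivAt.comp C.1 (hasFDerivAt_matrix_inv _ (isUnit_det_im C)) hB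
  have hAP := hA.mul' hP
  have h := ((symPart (Fin d ⊕ Fin d)) ∘ₗ fromBlocksLinear d).toContinuousLinearMap.hasFDerivAt.comp
    C.1 ((hP.prodMk (hP.mul' hA)).prodMk (hAP.prodMk ((hAP.mul' hA).add hB)))
  -- Symmetrization fixes symmetric matrices, so it turns the derivative of the matrix formula into
  -- one valued in the subspace.
  have hs : sigma (d := d) = fun D => symPart (Fin d ⊕ Fin d) (sigma D).1 := by
    ext1 D; exact (symPart_eq _ (sigma D).2).symm
  obtain ⟨f', hf', hval⟩ : ∃ f' : CSym d →L[ℝ] Sym2 d, HasFDerivAt sigma f' C.1 ∧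
      ∀ V, f' V = ⟨sigmaDeriv C.1 V, sigmaDeriv_transpose C.1 V⟩ := by
    rw [hs]
    refine ⟨_, h, fun V => ?_⟩
    rw [← symPart_eq]
    change symPart _ (fromBlocks _ _ _ _) = symPart _ (fromBlocks _ _ _ _)
    congr 2
    · change C.1.2.1⁻¹ * V.1.1 + -(C.1.2.1⁻¹ * V.2.1 * C.1.2.1⁻¹) * C.1.1.1 = _
      rw [add_comm]
    · change C.1.1.1 * -(C.1.2.1⁻¹ * V.2.1 * C.1.2.1⁻¹) + V.1.1 * C.1.2.1⁻¹ = _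
      rw [add_comm]
    · change C.1.1.1 * C.1.2.1⁻¹ * V.1.1 + (C.1.1.1 * -(C.1.2.1⁻¹ * V.2.1 * C.1.2.1⁻¹) +
        V.1.1 * C.1.2.1⁻¹) * C.1.1.1 + V.2.1 = _
      noncomm_ring
  exact ⟨hf'.differentiableAt, fun V => by rw [hf'.fderiv, hval]⟩

/-- The real and imaginary parts of a complex matrix, symmetrized; a left inverse of
`toComplex`. -/
noncomputable def ofComplex (d : ℕ) : Matrix (Fin d) (Fin d) ℂ →ₗ[ℝ] CSym d :=
  ((symPart (Fin d)) ∘ₗ Complex.reLm.mapMatrix).prod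
    ((symPart (Fin d)) ∘ₗ Complex.imLm.mapMatrix)

lemma ofComplex_toComplex (C : CSym d) : ofComplex d (toComplex C) = C := by
  refine Prod.ext ?_ ?_
  · change symPart _ ((toComplex C).map Complex.re) = _
    have : (toComplex C).map Complex.re = C.1.1 := by ext; simp [toComplex]
    rw [this, symPart_eq _ C.1.2]
  · change symPart _ ((toComplex C).map Complex.im) = _
    have : (toComplex C).map Complex.im = C.2.1 := by ext; simp [toComplex]
    rw [this, symPart_eq _ C.2.2]

/-- `denom` as a linear map in the group element. -/
def denomLinear (C : CSym d) :
    Matrix (Fin d ⊕ Fin d) (Fin d ⊕ Fin d) ℝ →ₗ[ℝ] Matrix (Fin d) (Fin d) ℂ where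
  toFun S := denom S C
  map_add' S T := by ext; simp [denom, Matrix.mul_apply, add_mul, Finset.sum_add_distrib,
    toBlocks₁₁, toBlocks₁₂]; ring
  map_smul' r S := by ext; simp [denom, Matrix.mul_apply, Finset.mul_sum, mul_assoc,
    toBlocks₁₁, toBlocks₁₂]

/-- `numer` as a linear map in the group element. -/
def numerLinear (C : CSym d) :
    Matrix (Fin d ⊕ Fin d) (Fin d ⊕ Fin d) ℝ →ₗ[ℝ] Matrix (Fin d) (Fin d) ℂ where
  toFun S := numer S C
  map_add' S T := by ext; simp [numer, Matrix.mul_apply, add_mul, Finset.sum_add_distrib,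
    toBlocks₂₁, toBlocks₂₂]; ring
  map_smul' r S := by ext; simp [numer, Matrix.mul_apply, Finset.mul_sum, mul_assoc,
    toBlocks₂₁, toBlocks₂₂]

lemma denom_one (C : CSym d) : denom 1 C = 1 := by
  rw [← fromBlocks_one, denom, toBlocks_fromBlocks₁₁, toBlocks_fromBlocks₁₂]; simp

lemma numer_one (C : CSym d) : numer 1 C = toComplex C := by
  rw [← fromBlocks_one, numer, toBlocks_fromBlocks₂₁, toBlocks_fromBlocks₂₂]; simp

/-- In complex form the field is `a + b 𝒞 + 𝒞 bᵀ + 𝒞 c 𝒞`. The right side is the derivative of `N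
D⁻¹` at the identity, where `N = 𝒞` and `D = 1`. -/
lemma toComplex_generatorField (a b c : Matrix (Fin d) (Fin d) ℝ) (ha : aᵀ = a) (hc : cᵀ = c)
    (C : CSym d) (ξ : Sym2 d) (hξ : ξ.1 = fromBlocks a b bᵀ c) :
    toComplex (generatorField a b c ha hc C) =
      numer (tilde ξ) C - toComplex C * denom (tilde ξ) C := by
  have ht : tilde ξ = fromBlocks (-bᵀ) (-c) a b := by
    rw [tilde, hξ, bbJ, fromBlocks_transpose, fromBlocks_multiply]
    simp
  have hadd : ∀ X Y : Matrix (Fin d) (Fin d) ℝ, (X + Y).map Complex.ofReal =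
      X.map Complex.ofReal + Y.map Complex.ofReal := fun X Y => by ext; simp
  have hsub : ∀ X Y : Matrix (Fin d) (Fin d) ℝ, (X - Y).map Complex.ofReal =
      X.map Complex.ofReal - Y.map Complex.ofReal := fun X Y => by ext; simp
  have hneg : ∀ X : Matrix (Fin d) (Fin d) ℝ, (-X).map Complex.ofReal =
      -X.map Complex.ofReal := fun X => by ext; simp
  rw [ht, numer, denom, toBlocks_fromBlocks₁₁, toBlocks_fromBlocks₁₂, toBlocks_fromBlocks₂₁,
    toBlocks_fromBlocks₂₂]
  simp only [toComplex, generatorField, hadd, hsub, hneg, ofReal_map_mul]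
  generalize C.1.1.map Complex.ofReal = A
  generalize C.2.1.map Complex.ofReal = B
  have hI : ∀ M : Matrix (Fin d) (Fin d) ℂ, Complex.I • Complex.I • M = -M := fun M => by
    rw [smul_smul, Complex.I_mul_I, neg_one_smul]
  simp only [Matrix.mul_add, Matrix.add_mul, Matrix.mul_neg, Matrix.neg_mul, Matrix.smul_mul,
    Matrix.mul_smul, smul_add, smul_neg, hI, Matrix.mul_assoc]
  abel

lemma hasDerivAt_Phi_oneParam (a b c : Matrix (Fin d) (Fin d) ℝ) (ha : aᵀ = a) (hc : cᵀ = c)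
    (C : UpperHalfSpace d) (ξ : Sym2 d) (hξ : ξ.1 = fromBlocks a b bᵀ c) :
    HasDerivAt (fun ε : ℝ => (Phi (oneParam ξ ε) C : CSym d)) (generatorField a b c ha hc C.1)
      0 := by
  have hE : HasDerivAt (fun ε : ℝ => NormedSpace.exp (ε • tilde ξ)) (tilde ξ) 0 := by
    have h := hasDerivAt_exp_smul_const (𝕂 := ℝ) (tilde ξ) 0
    rw [zero_smul, NormedSpace.exp_zero, one_mul] at h
    exact h
  have hN : HasDerivAt (fun ε : ℝ => numer (NormedSpace.exp (ε • tilde ξ)) C.1)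
      (numer (tilde ξ) C.1) 0 :=
    (numerLinear C.1).toContinuousLinearMap.hasFDerivAt.comp_hasDerivAt 0 hE
  have hD : HasDerivAt (fun ε : ℝ => denom (NormedSpace.exp (ε • tilde ξ)) C.1)
      (denom (tilde ξ) C.1) 0 :=
    (denomLinear C.1).toContinuousLinearMap.hasFDerivAt.comp_hasDerivAt 0 hE
  have h0 : denom (NormedSpace.exp ((0 : ℝ) • tilde ξ)) C.1 = 1 := by
    rw [zero_smul, NormedSpace.exp_zero, denom_one]
  have h0' : numer (NormedSpace.exp ((0 : ℝ) • tilde ξ)) C.1 = toComplex C.1 := by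
    rw [zero_smul, NormedSpace.exp_zero, numer_one]
  have hDi := (hasFDerivAt_matrix_inv (denom (NormedSpace.exp ((0 : ℝ) • tilde ξ)) C.1)
    (by rw [h0]; simp)).comp_hasDerivAt 0 hD
  have hF := hN.mul hDi
  have hr := (ofComplex d).toContinuousLinearMap.hasFDerivAt.comp_hasDerivAt 0 hF
  -- The left inverse of `toComplex` is linear, so the curve in real coordinates is a linear image
  -- of the complex curve differentiated in `hF`.
  have hfun : (fun ε : ℝ => (Phi (oneParam ξ ε) C : CSym d)) = fun ε : ℝ =>
      ofComplex d (numer (NormedSpace.exp (ε • tilde ξ)) C.1 *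
        (denom (NormedSpace.exp (ε • tilde ξ)) C.1)⁻¹) := by
    ext1 ε
    rw [← ofComplex_toComplex (Phi (oneParam ξ ε) C).1, toComplex_Phi]
    rfl
  rw [hfun, ← ofComplex_toComplex (generatorField a b c ha hc C.1),
    toComplex_generatorField _ _ _ _ _ _ _ hξ]
  have e : numer (tilde ξ) C.1 - toComplex C.1 * denom (tilde ξ) C.1 =
      numer (tilde ξ) C.1 * (denom (NormedSpace.exp ((0 : ℝ) • tilde ξ)) C.1)⁻¹ +
        numer (NormedSpace.exp ((0 : ℝ) • tilde ξ)) C.1 *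
          -((denom (NormedSpace.exp ((0 : ℝ) • tilde ξ)) C.1)⁻¹ * denom (tilde ξ) C.1 *
            (denom (NormedSpace.exp ((0 : ℝ) • tilde ξ)) C.1)⁻¹) := by
    simp only [h0, h0', inv_one, Matrix.mul_one, Matrix.one_mul, Matrix.mul_neg, sub_eq_add_neg]
  rw [e]
  exact hr

lemma deriv_Phi_oneParam (a b c : Matrix (Fin d) (Fin d) ℝ) (ha : aᵀ = a) (hc : cᵀ = c)
    (C : UpperHalfSpace d) (ξ : Sym2 d) (hξ : ξ.1 = fromBlocks a b bᵀ c) :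
    deriv (fun ε : ℝ => (Phi (oneParam ξ ε) C : CSym d)) 0 = generatorField a b c ha hc C.1 :=
  HasDerivAt.deriv (hasDerivAt_Phi_oneParam a b c ha hc C ξ hξ)

lemma differentiableAt_and_fderiv_symInv (P : Sym (Fin d)) (hP : IsUnit P.1.det) :
    DifferentiableAt ℝ (symInv (n := Fin d)) P ∧
      ∀ W, (fderiv ℝ symInv P W).1 = -(P.1⁻¹ * W.1 * P.1⁻¹) := by
  have h1 := HasFDerivAt.comp P (hasFDerivAt_matrix_inv _ hP)
    (Sym (Fin d)).subtypeL.hasFDerivAt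
  have h := (symPart (Fin d)).toContinuousLinearMap.hasFDerivAt.comp P h1
  have hs : symInv (n := Fin d) = fun D => symPart (Fin d) (symInv D).1 := by
    ext1 D; exact (symPart_eq _ (symInv D).2).symm
  obtain ⟨f', hf', hval⟩ : ∃ f' : Sym (Fin d) →L[ℝ] Sym (Fin d), HasFDerivAt symInv f' P ∧
      ∀ W, (f' W).1 = -(P.1⁻¹ * W.1 * P.1⁻¹) := by
    rw [hs]
    refine ⟨_, h, fun W => ?_⟩
    change (symPart _ (-(P.1⁻¹ * W.1 * P.1⁻¹))).1 = _
    rw [symPart_eq]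
    simp only [transpose_neg, transpose_mul, transpose_nonsing_inv, Sym.transpose_coe,
      Matrix.mul_assoc]
  exact ⟨hf'.differentiableAt, fun V => by rw [hf'.fderiv, hval]⟩

/-- A real function with vanishing derivative at every point of `ℍ_d` is constant on `ℍ_d`. -/
lemma eq_of_fderiv_eq_zero (f : CSym d → ℝ)
    (hf : ∀ C : UpperHalfSpace d, HasFDerivAt f (0 : CSym d →L[ℝ] ℝ) C.1)
    (C D : UpperHalfSpace d) : f C.1 = f D.1 := by
  have hconv : Convex ℝ (UpperHalfSpace d) := by
    intro X hX Y hY s t hs ht hst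
    change (s • X.2.1 + t • Y.2.1).PosDef
    -- Only a positive multiple of a positive definite matrix is known to be positive definite, so
    -- weight `0` is treated apart.
    rcases hs.eq_or_lt with rfl | hs
    · obtain rfl : t = 1 := by linarith
      simpa only [zero_smul, one_smul, zero_add] using (show Y.2.1.PosDef from hY)
    · exact (hX.smul hs).add_posSemidef (Matrix.PosDef.posSemidef hY |>.smul ht)
  have := hconv.norm_image_sub_le_of_norm_hasFDerivWithin_le (𝕜 := ℝ) (f := f) (C := 0)
    (f' := fun _ => 0) (fun x hx => (hf ⟨x, hx⟩).hasFDerivWithinAt) (by simp) D.2 C.2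
  simpa [sub_eq_zero] using this

end Norms

/-- Restated outside the section that fixes a norm on matrices: derivatives depend only on the
topology. -/
lemma differentiableAt_sigma (C : UpperHalfSpace d) :
    DifferentiableAt ℝ (sigma (d := d)) C.1 := (differentiableAt_and_fderiv_sigma C).1

lemma fderiv_sigma (C : UpperHalfSpace d) (V : CSym d) :
    fderiv ℝ sigma C.1 V = ⟨sigmaDeriv C.1 V, sigmaDeriv_transpose C.1 V⟩ :=
  (differentiableAt_and_fderiv_sigma C).2 V

lemma generator_eq (a b c : Matrix (Fin d) (Fin d) ℝ) (ha : aᵀ = a) (hc : cᵀ = c)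
    (C : UpperHalfSpace d) (ξ : Sym2 d) (hξ : ξ.1 = fromBlocks a b bᵀ c) :
    generator ξ C = generatorField a b c ha hc C.1 :=
  deriv_Phi_oneParam a b c ha hc C ξ hξ

lemma differentiableAt_symInv (P : Sym (Fin d)) (hP : IsUnit P.1.det) :
    DifferentiableAt ℝ (symInv (n := Fin d)) P := (differentiableAt_and_fderiv_symInv P hP).1

lemma fderiv_symInv (P W : Sym (Fin d)) (hP : IsUnit P.1.det) :
    (fderiv ℝ symInv P W).1 = -(P.1⁻¹ * W.1 * P.1⁻¹) := (differentiableAt_and_fderiv_symInv P hP).2 W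

lemma pairing_add_left {n : Type} [Fintype n] (ξ η ζ : Sym n) :
    pairing (ξ + η) ζ = pairing ξ ζ + pairing η ζ := by
  simp only [pairing, Submodule.coe_add, Matrix.add_mul, trace_add]

lemma pairing_smul_left {n : Type} [Fintype n] (r : ℝ) (ξ ζ : Sym n) :
    pairing (r • ξ) ζ = r * pairing ξ ζ := by
  simp only [pairing, Submodule.coe_smul, Matrix.smul_mul, trace_smul, smul_eq_mul]

lemma pairing_neg_left {n : Type} [Fintype n] (ξ ζ : Sym n) :
    pairing (-ξ) ζ = -pairing ξ ζ := by
  simp only [pairing, NegMemClass.coe_neg, Matrix.neg_mul, trace_neg]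

lemma pairing_sub_left {n : Type} [Fintype n] (ξ η ζ : Sym n) :
    pairing (ξ - η) ζ = pairing ξ ζ - pairing η ζ := by
  rw [sub_eq_add_neg, pairing_add_left, pairing_neg_left, sub_eq_add_neg]

/-! ### The momentum identity and its consequences -/

lemma Omega_generator (ξ : Sym2 d) (C : UpperHalfSpace d) (V : CSym d) :
    Omega C.1 (generator ξ C) V = pairing (fderiv ℝ sigma C.1 V) ξ := by
  obtain ⟨a, b, c, ha, hc, hξ⟩ := exists_blocks ξ
  rw [generator_eq a b c ha hc C ξ hξ, Omega_generatorField, fderiv_sigma, pairing, hξ]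

lemma fderiv_sigma_generator (ξ : Sym2 d) (C : UpperHalfSpace d) :
    fderiv ℝ sigma C.1 (generator ξ C) = -adStar ξ (sigma C.1) := by
  obtain ⟨a, b, c, ha, hc, hξ⟩ := exists_blocks ξ
  rw [generator_eq a b c ha hc C ξ hξ, fderiv_sigma]
  exact Subtype.ext (sigmaDeriv_generatorField a b c ha hc C ξ hξ)

/-- The infinitesimal action is transitive on `ℍ_d`. -/
lemma exists_generator_eq (C : UpperHalfSpace d) (U : CSym d) :
    ∃ ξ : Sym2 d, generator ξ C = U := by
  obtain ⟨a, b, c, ha, hc, h⟩ := exists_generatorField_eq C U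
  exact ⟨⟨fromBlocks a b bᵀ c, by
    change _ᵀ = _
    rw [fromBlocks_transpose, ha, hc, transpose_transpose]⟩, by
    rw [generator_eq a b c ha hc C _ rfl, h]⟩

lemma Omega_generator_generator (ξ η : Sym2 d) (C : UpperHalfSpace d) :
    Omega C.1 (generator ξ C) (generator η C) = pairing (sigma C.1) (symBracket ξ η) := by
  rw [Omega_generator, fderiv_sigma_generator, pairing_neg_left, pairing_adStar,
    ← symBracket_swap]

section Norms

open scoped Matrix.Norms.Operator

/-- The pairing with `ξ` as a continuous linear functional. -/
noncomputable def pairingCLM {n : Type} [Fintype n] [DecidableEq n] (ξ : Sym n) :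
    Sym n →L[ℝ] ℝ :=
  LinearMap.toContinuousLinearMap
    { toFun := fun η => pairing η ξ
      map_add' := fun η ζ => pairing_add_left η ζ ξ
      map_smul' := fun r η => pairing_smul_left r η ξ }

lemma hasFDerivAt_pairing_sigma (ξ : Sym2 d) (C : UpperHalfSpace d) :
    HasFDerivAt (fun D => pairing (sigma D) ξ) ((pairingCLM ξ).comp (fderiv ℝ sigma C.1)) C.1 :=
  (pairingCLM ξ).hasFDerivAt.comp C.1 (differentiableAt_sigma C).hasFDerivAt

lemma isMomentumMap_sigma : IsMomentumMap (sigma (d := d)) := fun ξ C =>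
  ⟨(hasFDerivAt_pairing_sigma ξ C).differentiableAt, fun V => by
    rw [Omega_generator, (hasFDerivAt_pairing_sigma ξ C).fderiv]
    rfl⟩

lemma hasFDerivAt_sub_zero {E : Type*} [NormedAddCommGroup E] [NormedSpace ℝ E] {f g : E → ℝ}
    {φ : E →L[ℝ] ℝ} {x : E} (hf : HasFDerivAt f φ x) (hg : HasFDerivAt g φ x) :
    HasFDerivAt (fun y => f y - g y) (0 : E →L[ℝ] ℝ) x := by
  have h := hf.sub hg
  rwa [sub_self] at h

/-- Momentum maps are constrained only through their pairings with fixed `ξ`, so the comparison is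
made for each `ξ` separately. -/
lemma IsMomentumMap.sub_sigma_eq {J : CSym d → Sym2 d} (hJ : IsMomentumMap J)
    (C D : UpperHalfSpace d) : J C.1 - sigma C.1 = J D.1 - sigma D.1 := by
  refine pairing_left_ext fun ξ => ?_
  refine eq_of_fderiv_eq_zero (fun X => pairing (J X - sigma X) ξ) (fun X => ?_) C D
  obtain ⟨h1, h1'⟩ := hJ ξ X
  obtain ⟨h2, h2'⟩ := isMomentumMap_sigma ξ X
  have h0 : fderiv ℝ (fun D => pairing (J D) ξ) X.1 = fderiv ℝ (fun D => pairing (sigma D) ξ) X.1 :=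
    ContinuousLinearMap.ext fun V => by rw [h1', h2']
  have hJ' := h1.hasFDerivAt
  rw [h0] at hJ'
  simp only [pairing_sub_left]
  exact hasFDerivAt_sub_zero hJ' h2.hasFDerivAt

/-! ### The Poisson property -/

lemma pairing_gradA (C : UpperHalfSpace d) (F : Sym2 d → ℝ)
    (hF : DifferentiableAt ℝ F (sigma C.1)) (W : Sym (Fin d)) :
    pairing (gradA (F ∘ sigma) C.1) W =
      Omega C.1 (generator (grad (fderiv ℝ F (sigma C.1))) C) (W, 0) := by
  rw [Omega_generator, pairing_comm (fderiv ℝ sigma C.1 _), pairing_grad, gradA, pairing_grad]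
  have hi : HasFDerivAt (fun A : Sym (Fin d) => ((A, C.1.2) : CSym d))
      (ContinuousLinearMap.inl ℝ (Sym (Fin d)) (Sym (Fin d))) C.1.1 :=
    hasFDerivAt_prodMk_left C.1.1 C.1.2
  have h := HasFDerivAt.comp C.1.1 (hF.hasFDerivAt.comp C.1 (differentiableAt_sigma C).hasFDerivAt)
    hi
  have h' : fderiv ℝ (fun A => (F ∘ sigma) (A, C.1.2)) C.1.1 = _ := h.fderiv
  rw [h']
  rfl

lemma symInv_symInv (C : UpperHalfSpace d) : symInv (symInv C.1.2) = C.1.2 :=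
  Subtype.ext (Matrix.nonsing_inv_nonsing_inv _ (isUnit_det_im C))

/-- Varying `ℬ⁻¹` in direction `W` moves `ℬ` by the derivative of inversion at `ℬ⁻¹`; the momentum
identity then applies to that tangent vector. -/
lemma pairing_gradBinv (C : UpperHalfSpace d) (F : Sym2 d → ℝ)
    (hF : DifferentiableAt ℝ F (sigma C.1)) (W : Sym (Fin d)) :
    pairing (gradBinv (F ∘ sigma) C.1) W =
      Omega C.1 (generator (grad (fderiv ℝ F (sigma C.1))) C)
        (0, fderiv ℝ symInv (symInv C.1.2) W) := by
  rw [Omega_generator, pairing_comm (fderiv ℝ sigma C.1 _), pairing_grad, gradBinv, pairing_grad]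
  have hu : IsUnit (symInv C.1.2).1.det :=
    (Matrix.isUnit_nonsing_inv_det_iff).2 (isUnit_det_im C)
  have hi : HasFDerivAt (fun P : Sym (Fin d) => ((C.1.1, symInv P) : CSym d))
      ((ContinuousLinearMap.inr ℝ (Sym (Fin d)) (Sym (Fin d))).comp
        (fderiv ℝ symInv (symInv C.1.2))) (symInv C.1.2) :=
    (hasFDerivAt_prodMk_right C.1.1 (symInv (symInv C.1.2))).comp (symInv C.1.2)
      (differentiableAt_symInv _ hu).hasFDerivAt
  -- The chain rule asks for the derivative of `F ∘ σ` at the doubly inverted point, which is `C`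
  -- only propositionally.
  have hC : ((C.1.1, symInv (symInv C.1.2)) : CSym d) = C.1 := by rw [symInv_symInv]
  have hFs : HasFDerivAt (F ∘ sigma)
      ((fderiv ℝ F (sigma C.1)).comp (fderiv ℝ sigma C.1)) (C.1.1, symInv (symInv C.1.2)) := by
    rw [hC]
    exact hF.hasFDerivAt.comp C.1 (differentiableAt_sigma C).hasFDerivAt
  have h := HasFDerivAt.comp (symInv C.1.2) hFs hi
  have h' : fderiv ℝ (fun P => (F ∘ sigma) (C.1.1, symInv P)) (symInv C.1.2) = _ := h.fderiv
  rw [h']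
  rfl

end Norms

lemma Omega_left_zero (C U : CSym d) (W : Sym (Fin d)) :
    Omega C U (W, 0) = (C.2.1⁻¹ * U.2.1 * C.2.1⁻¹ * W.1).trace := by
  simp [Omega_eq_trace]

lemma gradA_sigma (C : UpperHalfSpace d) (F : Sym2 d → ℝ)
    (hF : DifferentiableAt ℝ F (sigma C.1)) :
    (gradA (F ∘ sigma) C.1).1 =
      C.1.2.1⁻¹ * (generator (grad (fderiv ℝ F (sigma C.1))) C).2.1 * C.1.2.1⁻¹ := by
  have hs : (C.1.2.1⁻¹ * (generator (grad (fderiv ℝ F (sigma C.1))) C).2.1 * C.1.2.1⁻¹).IsSymm := by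
    change _ᵀ = _
    simp only [transpose_mul, transpose_nonsing_inv, Sym.transpose_coe, Matrix.mul_assoc]
  refine congrArg Subtype.val (pairing_left_ext (η := ⟨_, hs⟩) fun W => ?_)
  rw [pairing_gradA C F hF, Omega_left_zero]
  rfl

/-- Moving `ℬ⁻¹` by `ℬ⁻¹ U ℬ⁻¹` moves `ℬ` by `-U`. This sign cancels the one in `Ω`, leaving one of
the two trace terms of `Ω` on the generators. -/
lemma pairing_gradBinv_gradA (C : UpperHalfSpace d) (F G : Sym2 d → ℝ)
    (hF : DifferentiableAt ℝ F (sigma C.1)) (hG : DifferentiableAt ℝ G (sigma C.1)) :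
    pairing (gradBinv (F ∘ sigma) C.1) (gradA (G ∘ sigma) C.1) =
      (C.1.2.1⁻¹ * (generator (grad (fderiv ℝ G (sigma C.1))) C).2.1 * C.1.2.1⁻¹ *
        (generator (grad (fderiv ℝ F (sigma C.1))) C).1.1).trace := by
  have hu := isUnit_det_im C
  have hu' : IsUnit (symInv C.1.2).1.det := (Matrix.isUnit_nonsing_inv_det_iff).2 hu
  have hW : (fderiv ℝ symInv (symInv C.1.2) (gradA (G ∘ sigma) C.1)).1 =
      -(generator (grad (fderiv ℝ G (sigma C.1))) C).2.1 := by
    rw [fderiv_symInv _ _ hu', gradA_sigma C G hG]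
    change -((C.1.2.1⁻¹)⁻¹ * _ * (C.1.2.1⁻¹)⁻¹) = _
    rw [Matrix.nonsing_inv_nonsing_inv _ hu, Matrix.mul_assoc C.1.2.1⁻¹,
      Matrix.mul_nonsing_inv_cancel_left _ _ hu, Matrix.nonsing_inv_mul_cancel_right _ _ hu]
  rw [pairing_gradBinv C F hF, Omega_eq_trace, hW]
  simp

lemma poissonH_sigma (C : UpperHalfSpace d) (F G : Sym2 d → ℝ)
    (hF : DifferentiableAt ℝ F (sigma C.1)) (hG : DifferentiableAt ℝ G (sigma C.1)) :
    poissonH (F ∘ sigma) (G ∘ sigma) C.1 =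
      Omega C.1 (generator (grad (fderiv ℝ F (sigma C.1))) C)
        (generator (grad (fderiv ℝ G (sigma C.1))) C) := by
  have h : poissonH (F ∘ sigma) (G ∘ sigma) C.1 =
      -(pairing (gradBinv (F ∘ sigma) C.1) (gradA (G ∘ sigma) C.1) -
        pairing (gradBinv (G ∘ sigma) C.1) (gradA (F ∘ sigma) C.1)) := by
    simp only [poissonH, pairing_eq_sum, Finset.sum_sub_distrib]
  rw [h, pairing_gradBinv_gradA C F G hF hG, pairing_gradBinv_gradA C G F hG hF, Omega_eq_trace,
    neg_sub]

/-! ### The pullback of the KKS form -/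

lemma kksForm_eq (μ ξ η : Sym2 d) (X Y : orbitTangent μ) (hX : X.1 = adStar ξ μ)
    (hY : Y.1 = adStar η μ) : kksForm μ X Y = pairing μ (symBracket ξ η) := by
  obtain ⟨X, hX'⟩ := X
  obtain ⟨Y, hY'⟩ := Y
  dsimp only at hX hY
  subst hX hY
  exact kksForm_adStar μ ξ η

lemma adStar_neg (ξ μ : Sym2 d) : adStar (-ξ) μ = -adStar ξ μ := by
  refine Subtype.ext ?_
  simp only [adStar, NegMemClass.coe_neg]
  noncomm_ring

lemma symBracket_neg_neg (ξ η : Sym2 d) : symBracket (-ξ) (-η) = symBracket ξ η := by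
  refine Subtype.ext ?_
  simp only [symBracket, NegMemClass.coe_neg]
  noncomm_ring

lemma fderiv_sigma_mem_orbitTangent (C : UpperHalfSpace d) (U : CSym d) :
    fderiv ℝ sigma C.1 U ∈ orbitTangent (sigma C.1) := by
  obtain ⟨ξ, rfl⟩ := exists_generator_eq C U
  exact ⟨-ξ, by rw [fderiv_sigma_generator, adStar_neg]⟩

/-- Every tangent vector is a generator, and `dσ` sends the generator of `ξ` to `ad*_{-ξ} σ`; the
two minus signs cancel in the bracket. -/
lemma kksForm_fderiv_sigma (C : UpperHalfSpace d) (U V : CSym d) :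
    kksForm (sigma C.1) ⟨fderiv ℝ sigma C.1 U, fderiv_sigma_mem_orbitTangent C U⟩
      ⟨fderiv ℝ sigma C.1 V, fderiv_sigma_mem_orbitTangent C V⟩ = Omega C.1 U V := by
  obtain ⟨ξ, rfl⟩ := exists_generator_eq C U
  obtain ⟨η, rfl⟩ := exists_generator_eq C V
  have h : ∀ ζ : Sym2 d, fderiv ℝ sigma C.1 (generator ζ C) = adStar (-ζ) (sigma C.1) :=
    fun ζ => by rw [fderiv_sigma_generator, adStar_neg]
  rw [kksForm_eq _ (-ξ) (-η) _ _ (h ξ) (h η), symBracket_neg_neg, Omega_generator_generator]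

/-! ### Uniqueness of the momentum map -/

/-- The point `i I` of `ℍ_d`. -/
def basePoint (d : ℕ) : UpperHalfSpace d :=
  ⟨(0, ⟨1, Matrix.isSymm_one⟩), Matrix.PosDef.one⟩

lemma IsMomentumMap.exists_eq_sigma_add {J : CSym d → Sym2 d} (hJ : IsMomentumMap J) :
    ∃ c : Sym2 d, ∀ C : UpperHalfSpace d, J C.1 = sigma C.1 + c :=
  ⟨J (basePoint d).1 - sigma (basePoint d).1, fun C => by
    rw [← hJ.sub_sigma_eq C (basePoint d), add_sub_cancel]⟩

lemma coAd_add (S : symplecticGroup (Fin d) ℝ) (μ ν : Sym2 d) :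
    coAd S (μ + ν) = coAd S μ + coAd S ν := by
  refine Subtype.ext ?_
  simp only [coAd, Submodule.coe_add, Matrix.mul_add, Matrix.add_mul]

lemma IsMomentumMap.eq_sigma {J : CSym d → Sym2 d} (hJ : IsMomentumMap J)
    (hE : IsEquivariant J) (C : UpperHalfSpace d) : J C.1 = sigma C.1 := by
  obtain ⟨c, hc⟩ := hJ.exists_eq_sigma_add
  -- Subtracting the equivariance of `σ` from that of `J = σ + c` leaves `c` fixed by every `S`.
  have hc0 : c = 0 := eq_zero_of_coAd_eq c fun S => by
    have h := hE S C
    rw [hc, hc, coAd_add, isEquivariant_sigma] at h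
    exact (add_left_cancel h).symm
  rw [hc, hc0, add_zero]

end Siegel

theorem theorem3p2 (d : ℕ) :
    -- (i) `σ` is a momentum map of `Φ`, and a momentum map is unique up to an additive constant
    (Siegel.IsMomentumMap (Siegel.sigma (d := d)) ∧
      ∀ J : Siegel.CSym d → Siegel.Sym2 d, Siegel.IsMomentumMap J →
        ∃ c : Siegel.Sym2 d, ∀ C : Siegel.UpperHalfSpace d, J C.1 = Siegel.sigma C.1 + c) ∧
    -- (ii) `σ` is equivariant, and it is the only equivariant momentum map of `Φ`
    (Siegel.IsEquivariant (Siegel.sigma (d := d)) ∧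
      (∀ (S : Matrix.symplecticGroup (Fin d) ℝ) (C : Siegel.UpperHalfSpace d),
        (Siegel.sigma (Siegel.Phi S C).1).1 = S.1 * (Siegel.sigma C.1).1 * (S.1).transpose) ∧
      ∀ J : Siegel.CSym d → Siegel.Sym2 d, Siegel.IsMomentumMap J → Siegel.IsEquivariant J →
        ∀ C : Siegel.UpperHalfSpace d, J C.1 = Siegel.sigma C.1) ∧
    -- (iii) `σ` is a Poisson map
    (∀ (C : Siegel.UpperHalfSpace d) (F G : Siegel.Sym2 d → ℝ),
      DifferentiableAt ℝ F (Siegel.sigma C.1) → DifferentiableAt ℝ G (Siegel.sigma C.1) →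
        Siegel.liePoisson F G (Siegel.sigma C.1) =
          Siegel.poissonH (F ∘ Siegel.sigma) (G ∘ Siegel.sigma) C.1) ∧
    -- (iv) `σ` maps `ℍ_d` onto a coadjoint orbit, and pulls back its KKS form to `Ω`
    (∀ C : Siegel.UpperHalfSpace d,
      Siegel.sigma '' Siegel.UpperHalfSpace d = Siegel.coadjointOrbit (Siegel.sigma C.1) ∧
      DifferentiableAt ℝ Siegel.sigma C.1 ∧
      ∃ hT : ∀ U : Siegel.CSym d,
          fderiv ℝ Siegel.sigma C.1 U ∈ Siegel.orbitTangent (Siegel.sigma C.1),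
        ∀ U V : Siegel.CSym d,
          Siegel.kksForm (Siegel.sigma C.1) ⟨fderiv ℝ Siegel.sigma C.1 U, hT U⟩
            ⟨fderiv ℝ Siegel.sigma C.1 V, hT V⟩ = Siegel.Omega C.1 U V) := by
  refine ⟨⟨Siegel.isMomentumMap_sigma, fun J hJ => hJ.exists_eq_sigma_add⟩,
    ⟨Siegel.isEquivariant_sigma, Siegel.sigma_Phi, fun J hJ hE => hJ.eq_sigma hE⟩,
    fun C F G hF hG => ?_, fun C => ⟨Siegel.sigma_image C, Siegel.differentiableAt_sigma C,
      Siegel.fderiv_sigma_mem_orbitTangent C, Siegel.kksForm_fderiv_sigma C⟩⟩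
  rw [Siegel.poissonH_sigma C F G hF hG, Siegel.Omega_generator_generator, Siegel.liePoisson]
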